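/- Let $r\ge 1$ and let $\mathcal E$ be a $(1+1)$-dimensional evolution equation $$u_t=H(t,x,u_0,u_1,\dots,u_r),\qquad u_k=\partial^k u/\partial x^k,$$ where $H$ is a $C^\infty$ real function on an open set $\Omega\subset\mathbb R^{r+3}$ with $H_{u_r}\neq0$ on $\Omega$. Let $\rho\ge1$. For a function $f(t,x,\bar c)$, $\bar c\in\mathbb R^\rho$, put $f_k=\partial^k f/\partial x^k$. All objects are local (defined and smooth near a point), and reparametrizations are smooth with smooth inverse. * A *family of solutions* near $(t_0,x_0,\bar\varkappa_0)$ is a smooth function $u=f(t,x,\bar\varkappa)$ which solves $\mathcal E$ for each $\bar\varkappa$ (in particular, its $x$-jet lies in $\Omega$). Its parameters are *essential* at this point if on no neighbourhood of the point $f(t,x,\bar\varkappa)=g(t,x,\zeta^1(\bar\varkappa),\dots,\zeta^n(\bar\varkappa))$ with smooth $g,\zeta$ and $n<\rho$. The point is *regular* for $f$ if for each $k\le\rho$ the rank of $\partial(f_0,\dots,f_{k-1})/\partial\bar\varkappa$ is constant near it. A *$\rho$-parametric family of solutions* near $(t_0,x_0)$ is a family of solutions near a regular point $(t_0,x_0,\bar\varkappa_0)$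 at which the parameters are essential. Families $f$ near $\bar\varkappa_0$ and $f'$ near $\bar\varkappa_0'$ are *equivalent* if $f'(t,x,\bar\zeta(\bar\varkappa))=f(t,x,\bar\varkappa)$ near $(t_0,x_0,\bar\varkappa_0)$ for a local diffeomorphism $\bar\zeta$ with $\bar\zeta(\bar\varkappa_0)=\bar\varkappa_0'$. * An *ansatz* near $(t_0,x_0)$ is an expression $u=F(t,x,\bar\varphi(t))$, $\bar\varphi=(\varphi^1,\dots,\varphi^\rho)$, with $F$ smooth near a point $(t_0,x_0,\bar c_0)$ at which $\det\Phi\ne0$, where $\Phi=\partial(F_0,\dots,F_{\rho-1})/\partial\bar\varphi$. Ansatzes $F$ near $\bar c_0$ and $F'$ near $\bar c_0'$ are *equivalent* if $F'(t,x,\bar\zeta(t,\bar\varphi))=F(t,x,\bar\varphi)$ near $(t_0,x_0,\bar c_0)$ for a smooth $\bar\zeta(t,\bar\varphi)$ that is locally invertible with respect to $\bar\varphi$ (with smooth inverse) and has $\bar\zeta(t_0,\bar c_0)=\bar c_0'$. * Put $\tilde H(t,x,\bar\varphi)=H(t,x,F_0,\dots,F_r)$. Substituting the ansatz into $\mathcal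 E$, differentiating in $x$ up to order $\rho-1$ and solving for $\bar\varphi_t$ gives $\varphi^a_t=G^a:=\sum_b(\Phi^{-1})^{ab}\,\partial_x^{\,b-1}(\tilde H-F_t)$. The ansatz *reduces* $\mathcal E$ if $(t_0,x_0,F_0,\dots,F_r)\in\Omega$ at the base point and all $G^a$ are independent of $x$ near it; the system $\bar\varphi_t=\bar G(t,\bar\varphi)$ is then the reduced system. Its general solution is a smooth $\bar\varphi=\bar\psi(t,\bar\varkappa)$ near $(t_0,\bar\varkappa_0)$ with $\bar\psi(t_0,\bar\varkappa_0)=\bar c_0$, $\bar\psi_t=\bar G(t,\bar\psi)$ and $\det(\partial\bar\psi/\partial\bar\varkappa)\neq0$ at $(t_0,\bar\varkappa_0)$. **Theorem.** (1) For every $(t_0,x_0)$ there is a bijection between the equivalence classes of $\rho$-parametric families of solutions of $\mathcal E$ near $(t_0,x_0)$ and the equivalence classes of ansatzes near $(t_0,x_0)$ that reduce $\mathcal E$. The class of a family $f$ corresponds to the class of a reducing ansatz $F$ if and only if $f(t,x,\bar\varkappa)=F(t,x,\bar\psi(t,\bar\varkappa))$ near $(t_0,x_0,\bar\varkappa_0)$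 for a general solution $\bar\psi$ of the reduced system. Moreover, for each $\rho$-parametric family of solutions $f$, the expression $u=f(t,x,\bar\varphi(t))$ is itself an ansatz which reduces $\mathcal E$ to the system $\bar\varphi_t=0$, and its class corresponds to the class of $f$. (2) The regularity requirement only excludes non-generic points: if $f$ is a family of solutions of $\mathcal E$ on an open set $U\subset\mathbb R^{2+\rho}$ whose parameters are essential at each point of $U$, then the regular points of $f$ are dense in $U$. -/

import Mathlib

open Filter Topology
open scoped ContDiff

noncomputable section

namespace EvolAnsatz

/-- Tuples of `n` real numbers. -/
abbrev Vec (n : ℕ) : Type := Fin n → ℝ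

/-- `g` is smooth (of class `C^∞`) on a neighbourhood of `p`. -/
def SmoothNear {V W : Type*} [NormedAddCommGroup V] [NormedSpace ℝ V]
    [NormedAddCommGroup W] [NormedSpace ℝ W] (g : V → W) (p : V) : Prop :=
  ∀ᶠ q in 𝓝 p, ContDiffAt ℝ ∞ g q

/-- An evolution equation `u_t = H(t, x, u_0, …, u_r)`, `r ≥ 1`, where `u_k = ∂^k u / ∂x^k`, with
`H` smooth on an open set `dom` of the space of `(t, x, u_0, …, u_r)` and `∂H/∂u_r ≠ 0` there. -/
structure EvolEq where
  r : ℕ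
  one_le_r : 1 ≤ r
  dom : Set (ℝ × ℝ × Vec (r + 1))
  isOpen_dom : IsOpen dom
  H : ℝ × ℝ × Vec (r + 1) → ℝ
  smooth_H : ContDiffOn ℝ ∞ H dom
  H_ur_ne_zero : ∀ p ∈ dom, fderiv ℝ H p (0, 0, Pi.single (Fin.last r) 1) ≠ 0

section Functions

variable {ρ : ℕ}

/-- The derivative `f_k = ∂^k f / ∂x^k` of a function `f(t, x, c)`. -/
def dx (k : ℕ) (f : ℝ → ℝ → Vec ρ → ℝ) (t x : ℝ) (c : Vec ρ) : ℝ :=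
  iteratedDeriv k (fun y => f t y c) x

/-- The derivative `f_t = ∂f / ∂t` of a function `f(t, x, c)`. -/
def dt (f : ℝ → ℝ → Vec ρ → ℝ) (t x : ℝ) (c : Vec ρ) : ℝ :=
  deriv (fun s => f s x c) t

/-- The point `(t, x, f_0, …, f_r)` at which the function `H` of an equation of order `r` is
evaluated when `u = f(t, x, c)` is substituted. -/
def xJet (r : ℕ) (f : ℝ → ℝ → Vec ρ → ℝ) (t x : ℝ) (c : Vec ρ) : ℝ × ℝ × Vec (r + 1) :=
  (t, x, fun k => dx k f t x c)

/-- The `k × ρ` matrix `∂(f_0, …, f_{k-1}) / ∂(c_1, …, c_ρ)`. -/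
def xJacobian (k : ℕ) (f : ℝ → ℝ → Vec ρ → ℝ) (t x : ℝ) (c : Vec ρ) :
    Matrix (Fin k) (Fin ρ) ℝ :=
  Matrix.of fun i b => fderiv ℝ (fun c' => dx i f t x c') c (Pi.single b 1)

/-- Near `(t₀, x₀, κ₀)`, the function `f(t, x, κ)` is smooth and, for each value of the parameters
`κ`, is a solution of the equation `E`. -/
def IsSolutionFamilyAt (E : EvolEq) (f : ℝ → ℝ → Vec ρ → ℝ) (t₀ x₀ : ℝ) (κ₀ : Vec ρ) : Prop :=
  SmoothNear (fun p : ℝ × ℝ × Vec ρ => f p.1 p.2.1 p.2.2) (t₀, x₀, κ₀) ∧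
  xJet E.r f t₀ x₀ κ₀ ∈ E.dom ∧
  ∀ᶠ p in 𝓝 (t₀, x₀, κ₀), dt f p.1 p.2.1 p.2.2 = E.H (xJet E.r f p.1 p.2.1 p.2.2)

/-- The parameters of `f(t, x, κ)` are essential near `(t₀, x₀, κ₀)`: there is no local
representation `f(t, x, κ) = g(t, x, ζ¹(κ), …, ζⁿ(κ))` with smooth `g`, `ζ` and `n < ρ`. -/
def EssentialParametersAt (f : ℝ → ℝ → Vec ρ → ℝ) (t₀ x₀ : ℝ) (κ₀ : Vec ρ) : Prop :=
  ¬ ∃ n : ℕ, n < ρ ∧ ∃ (g : ℝ → ℝ → Vec n → ℝ) (ζ : Vec ρ → Vec n),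
    SmoothNear ζ κ₀ ∧
    SmoothNear (fun p : ℝ × ℝ × Vec n => g p.1 p.2.1 p.2.2) (t₀, x₀, ζ κ₀) ∧
    ∀ᶠ p in 𝓝 (t₀, x₀, κ₀), f p.1 p.2.1 p.2.2 = g p.1 p.2.1 (ζ p.2.2)

/-- `(t₀, x₀, κ₀)` is a regular (generic) point of `f(t, x, κ)`: for each `k ≤ ρ` the rank of
`∂(f_0, …, f_{k-1}) / ∂κ` is constant near this point. -/
def RegularAt (f : ℝ → ℝ → Vec ρ → ℝ) (t₀ x₀ : ℝ) (κ₀ : Vec ρ) : Prop :=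
  ∀ k ≤ ρ, ∀ᶠ p in 𝓝 (t₀, x₀, κ₀),
    (xJacobian k f p.1 p.2.1 p.2.2).rank = (xJacobian k f t₀ x₀ κ₀).rank

/-- `ζ` is a smooth invertible vector-function from a neighbourhood of `κ₀` onto a neighbourhood
of `κ₁ = ζ(κ₀)`. -/
def IsReparam (ζ : Vec ρ → Vec ρ) (κ₀ κ₁ : Vec ρ) : Prop :=
  ζ κ₀ = κ₁ ∧ SmoothNear ζ κ₀ ∧ ∃ ξ : Vec ρ → Vec ρ, SmoothNear ξ κ₁ ∧
    (∀ᶠ κ in 𝓝 κ₀, ξ (ζ κ) = κ) ∧ ∀ᶠ κ in 𝓝 κ₁, ζ (ξ κ) = κ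

/-- `ζ(t, φ)` is a smooth vector-function near `(t₀, c₀)`, `ζ(t₀, c₀) = c₁`, which is invertible
with respect to `φ` with smooth inverse. -/
def IsTimeReparam (ζ : ℝ → Vec ρ → Vec ρ) (t₀ : ℝ) (c₀ c₁ : Vec ρ) : Prop :=
  ζ t₀ c₀ = c₁ ∧ SmoothNear (fun p : ℝ × Vec ρ => ζ p.1 p.2) (t₀, c₀) ∧
  ∃ ξ : ℝ → Vec ρ → Vec ρ, SmoothNear (fun p : ℝ × Vec ρ => ξ p.1 p.2) (t₀, c₁) ∧
    (∀ᶠ p in 𝓝 (t₀, c₀), ξ p.1 (ζ p.1 p.2) = p.2) ∧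
    ∀ᶠ p in 𝓝 (t₀, c₁), ζ p.1 (ξ p.1 p.2) = p.2

/-- The right-hand sides `G^a = Φ̂^{ab} (H̃ - F_t)_{b-1}`, as functions of `(t, x, φ)`, of the
system for `φ_t` which results from substituting the ansatz `u = F(t, x, φ(t))` into `E`.
Here `Φ = ∂(F_0, …, F_{ρ-1})/∂φ`, `Φ̂ = Φ⁻¹`, `H̃(t, x, φ) = H(t, x, F_0, …, F_r)`, and the
subscript `b - 1` denotes the derivative of order `b - 1` in `x`. -/
def reducedRHS (E : EvolEq) (F : ℝ → ℝ → Vec ρ → ℝ) (t x : ℝ) (c : Vec ρ) : Vec ρ :=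
  Matrix.mulVec (xJacobian ρ F t x c)⁻¹
    fun b => dx b (fun t x c => E.H (xJet E.r F t x c) - dt F t x c) t x c

/-- Near `(t₀, x₀, c₀)` the right-hand sides above do not depend on `x` and are equal to
`G(t, φ)`; thus `φ_t = G(t, φ)` is the reduced system. -/
def IsReducedSystem (E : EvolEq) (F : ℝ → ℝ → Vec ρ → ℝ) (t₀ x₀ : ℝ) (c₀ : Vec ρ)
    (G : ℝ → Vec ρ → Vec ρ) : Prop :=
  ∀ᶠ p in 𝓝 (t₀, x₀, c₀), reducedRHS E F p.1 p.2.1 p.2.2 = G p.1 p.2.2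

/-- `φ = ψ(t, κ)` is, near `(t₀, κ₀)`, the general solution of the system `φ_t = G(t, φ)` near
`(t₀, c₀)`: a smooth family of solutions with `det(∂ψ/∂κ) ≠ 0`. -/
def IsGeneralSolution (G : ℝ → Vec ρ → Vec ρ) (ψ : ℝ → Vec ρ → Vec ρ)
    (t₀ : ℝ) (c₀ κ₀ : Vec ρ) : Prop :=
  ψ t₀ κ₀ = c₀ ∧ SmoothNear (fun p : ℝ × Vec ρ => ψ p.1 p.2) (t₀, κ₀) ∧
  (∀ᶠ p in 𝓝 (t₀, κ₀), HasDerivAt (fun s => ψ s p.2) (G p.1 (ψ p.1 p.2)) p.1) ∧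
  (Matrix.of fun a b : Fin ρ => fderiv ℝ (ψ t₀) κ₀ (Pi.single b 1) a).det ≠ 0

end Functions

/-- A (local) `ρ`-parametric family `u = f(t, x, κ)` of solutions of `E`, near `(t₀, x₀)` and near
the value `κ₀` of the parameters: the parameters are essential, and the point `(t₀, x₀, κ₀)` is
a regular point. -/
structure SolutionFamily (E : EvolEq) (ρ : ℕ) (t₀ x₀ : ℝ) where
  f : ℝ → ℝ → Vec ρ → ℝ
  κ₀ : Vec ρ
  isSolution : IsSolutionFamilyAt E f t₀ x₀ κ₀
  essential : EssentialParametersAt f t₀ x₀ κ₀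
  regular : RegularAt f t₀ x₀ κ₀

/-- A (local) ansatz `u = F(t, x, φ(t))`, `φ = (φ^1, …, φ^ρ)`, near `(t₀, x₀)` and near the value
`c₀` of `φ`, with `det Φ ≠ 0`. -/
structure Ansatz (ρ : ℕ) (t₀ x₀ : ℝ) where
  F : ℝ → ℝ → Vec ρ → ℝ
  c₀ : Vec ρ
  smooth_F : SmoothNear (fun p : ℝ × ℝ × Vec ρ => F p.1 p.2.1 p.2.2) (t₀, x₀, c₀)
  det_ne_zero : (xJacobian ρ F t₀ x₀ c₀).det ≠ 0

/-- The ansatz reduces the equation `E`: it can be substituted into `E`, and the right-hand sides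
of the resulting system for `φ_t` do not depend on `x`. -/
def Ansatz.Reduces {ρ : ℕ} {t₀ x₀ : ℝ} (A : Ansatz ρ t₀ x₀) (E : EvolEq) : Prop :=
  xJet E.r A.F t₀ x₀ A.c₀ ∈ E.dom ∧
  ∃ G : ℝ → Vec ρ → Vec ρ, IsReducedSystem E A.F t₀ x₀ A.c₀ G

/-- The ansatzes that reduce the equation `E`. -/
abbrev ReducingAnsatz (E : EvolEq) (ρ : ℕ) (t₀ x₀ : ℝ) : Type :=
  {A : Ansatz ρ t₀ x₀ // A.Reduces E}

/-- Equivalence of parametric families: they differ only by the parametrization. -/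
def SolutionFamily.Equivalent {E : EvolEq} {ρ : ℕ} {t₀ x₀ : ℝ}
    (S S' : SolutionFamily E ρ t₀ x₀) : Prop :=
  ∃ ζ : Vec ρ → Vec ρ, IsReparam ζ S.κ₀ S'.κ₀ ∧
    ∀ᶠ p in 𝓝 (t₀, x₀, S.κ₀), S'.f p.1 p.2.1 (ζ p.2.2) = S.f p.1 p.2.1 p.2.2

/-- Equivalence of ansatzes: `F²(t, x, ζ(t, φ)) = F¹(t, x, φ)` for some `ζ` invertible in `φ`. -/
def Ansatz.Equivalent {ρ : ℕ} {t₀ x₀ : ℝ} (A A' : Ansatz ρ t₀ x₀) : Prop :=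
  ∃ ζ : ℝ → Vec ρ → Vec ρ, IsTimeReparam ζ t₀ A.c₀ A'.c₀ ∧
    ∀ᶠ p in 𝓝 (t₀, x₀, A.c₀), A'.F p.1 p.2.1 (ζ p.1 p.2.2) = A.F p.1 p.2.1 p.2.2

/-- The family `u = f(t, x, κ)` is obtained from the ansatz `u = F(t, x, φ(t))` by substituting
the general solution `φ = ψ(t, κ)` of the reduced system. -/
def SolutionFamily.IsObtainedFrom {E : EvolEq} {ρ : ℕ} {t₀ x₀ : ℝ}
    (S : SolutionFamily E ρ t₀ x₀) (A : Ansatz ρ t₀ x₀) : Prop :=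
  ∃ G ψ : ℝ → Vec ρ → Vec ρ, IsReducedSystem E A.F t₀ x₀ A.c₀ G ∧
    IsGeneralSolution G ψ t₀ A.c₀ S.κ₀ ∧
    ∀ᶠ p in 𝓝 (t₀, x₀, S.κ₀), S.f p.1 p.2.1 p.2.2 = A.F p.1 p.2.1 (ψ p.1 p.2.2)

/-! Both equivalences are equivalence relations. -/

section Equivalences

variable {ρ : ℕ}

theorem SmoothNear.continuousAt {V W : Type*} [NormedAddCommGroup V] [NormedSpace ℝ V]
    [NormedAddCommGroup W] [NormedSpace ℝ W] {g : V → W} {p : V} (h : SmoothNear g p) :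
    ContinuousAt g p :=
  h.self_of_nhds.continuousAt

theorem SmoothNear.comp {V W X : Type*} [NormedAddCommGroup V] [NormedSpace ℝ V]
    [NormedAddCommGroup W] [NormedSpace ℝ W] [NormedAddCommGroup X] [NormedSpace ℝ X]
    {g : W → X} {f : V → W} {p : V} (hg : SmoothNear g (f p)) (hf : SmoothNear f p) :
    SmoothNear (fun q => g (f q)) p := by
  have h := hf.continuousAt.eventually hg
  filter_upwards [h, hf] with q h1 h2
  exact ContDiffAt.comp q h1 h2

theorem IsReparam.refl (κ : Vec ρ) : IsReparam (fun c => c) κ κ :=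
  ⟨rfl, Eventually.of_forall fun _ => contDiffAt_id, fun c => c,
    Eventually.of_forall fun _ => contDiffAt_id, Eventually.of_forall fun _ => rfl,
    Eventually.of_forall fun _ => rfl⟩

theorem IsReparam.comp {ζ ζ' : Vec ρ → Vec ρ} {a b c : Vec ρ} (h : IsReparam ζ a b)
    (h' : IsReparam ζ' b c) : IsReparam (fun κ => ζ' (ζ κ)) a c := by
  obtain ⟨rfl, hs, ξ, hξ, h1, h2⟩ := h
  obtain ⟨rfl, hs', ξ', hξ', h1', h2'⟩ := h'
  have e1 : ξ (ζ a) = a := h1.self_of_nhds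
  have e2 : ξ' (ζ' (ζ a)) = ζ a := h1'.self_of_nhds
  have cξ' : Tendsto ξ' (𝓝 (ζ' (ζ a))) (𝓝 (ζ a)) := by
    simpa [ContinuousAt, e2] using hξ'.continuousAt
  have cξ : Tendsto ξ (𝓝 (ζ a)) (𝓝 a) := by
    simpa [ContinuousAt, e1] using hξ.continuousAt
  refine ⟨rfl, SmoothNear.comp hs' hs, fun κ => ξ (ξ' κ), ?_, ?_, ?_⟩
  · exact SmoothNear.comp (by rw [e2]; exact hξ) hξ'
  · filter_upwards [hs.continuousAt.eventually h1', h1] with κ k1 k2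
    rw [k1, k2]
  · filter_upwards [cξ'.eventually h2, h2'] with κ k1 k2
    rw [k1, k2]

theorem IsTimeReparam.refl (t₀ : ℝ) (c : Vec ρ) : IsTimeReparam (fun _ c => c) t₀ c c :=
  ⟨rfl, Eventually.of_forall fun _ => contDiffAt_snd, fun _ c => c,
    Eventually.of_forall fun _ => contDiffAt_snd, Eventually.of_forall fun _ => rfl,
    Eventually.of_forall fun _ => rfl⟩

theorem SmoothNear.withTime {ζ : ℝ → Vec ρ → Vec ρ} {p : ℝ × Vec ρ}
    (h : SmoothNear (fun p : ℝ × Vec ρ => ζ p.1 p.2) p) :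
    SmoothNear (fun p : ℝ × Vec ρ => (p.1, ζ p.1 p.2)) p := by
  filter_upwards [h] with q hq
  exact contDiffAt_fst.prodMk hq

theorem IsTimeReparam.comp {ζ ζ' : ℝ → Vec ρ → Vec ρ} {t₀ : ℝ} {a b c : Vec ρ}
    (h : IsTimeReparam ζ t₀ a b) (h' : IsTimeReparam ζ' t₀ b c) :
    IsTimeReparam (fun t κ => ζ' t (ζ t κ)) t₀ a c := by
  obtain ⟨rfl, hs, ξ, hξ, h1, h2⟩ := h
  obtain ⟨rfl, hs', ξ', hξ', h1', h2'⟩ := h'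
  have e2 : ξ' t₀ (ζ' t₀ (ζ t₀ a)) = ζ t₀ a := h1'.self_of_nhds
  have cξ' : Tendsto (fun p : ℝ × Vec ρ => (p.1, ξ' p.1 p.2)) (𝓝 (t₀, ζ' t₀ (ζ t₀ a)))
      (𝓝 (t₀, ζ t₀ a)) := by
    simpa [ContinuousAt, e2] using hξ'.withTime.continuousAt
  refine ⟨rfl, SmoothNear.comp (g := fun p : ℝ × Vec ρ => ζ' p.1 p.2)
      (f := fun p : ℝ × Vec ρ => (p.1, ζ p.1 p.2)) hs' hs.withTime,
    fun t κ => ξ t (ξ' t κ), ?_, ?_, ?_⟩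
  · exact SmoothNear.comp (g := fun p : ℝ × Vec ρ => ξ p.1 p.2)
      (f := fun p : ℝ × Vec ρ => (p.1, ξ' p.1 p.2)) (by simpa [e2] using hξ) hξ'.withTime
  · filter_upwards [hs.withTime.continuousAt.eventually h1', h1] with κ k1 k2
    rw [k1, k2]
  · filter_upwards [cξ'.eventually h2, h2'] with κ k1 k2
    rw [k1, k2]

variable {E : EvolEq} {t₀ x₀ : ℝ}

theorem SolutionFamily.equivalence :
    Equivalence (SolutionFamily.Equivalent (E := E) (ρ := ρ) (t₀ := t₀) (x₀ := x₀)) where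
  refl S := ⟨fun c => c, IsReparam.refl _, Eventually.of_forall fun _ => rfl⟩
  symm := by
    rintro S S' ⟨ζ, ⟨e, hs, ξ, hξ, h1, h2⟩, hf⟩
    have e1 : ξ S'.κ₀ = S.κ₀ := by rw [← e]; exact h1.self_of_nhds
    refine ⟨ξ, ⟨e1, hξ, ζ, hs, h2, h1⟩, ?_⟩
    have c0 : Tendsto (fun p : ℝ × ℝ × Vec ρ => ξ p.2.2) (𝓝 (t₀, x₀, S'.κ₀)) (𝓝 S.κ₀) := by
      have h3 : Tendsto ξ (𝓝 S'.κ₀) (𝓝 S.κ₀) := by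
        simpa [ContinuousAt, e1] using hξ.continuousAt
      exact h3.comp (Continuous.tendsto' (by fun_prop) _ _ rfl)
    have c1 : Tendsto (fun p : ℝ × ℝ × Vec ρ => (p.1, p.2.1, ξ p.2.2)) (𝓝 (t₀, x₀, S'.κ₀))
        (𝓝 (t₀, x₀, S.κ₀)) :=
      (Continuous.tendsto' (by fun_prop) _ _ rfl).prodMk_nhds
        ((Continuous.tendsto' (by fun_prop) _ _ rfl).prodMk_nhds c0)
    have c2 : Tendsto (fun p : ℝ × ℝ × Vec ρ => p.2.2) (𝓝 (t₀, x₀, S'.κ₀)) (𝓝 S'.κ₀) :=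
      Continuous.tendsto' (by fun_prop) _ _ rfl
    filter_upwards [c1.eventually hf, c2.eventually h2] with p k1 k2
    rw [← k1, k2]
  trans := by
    rintro S S' S'' ⟨ζ, h, hf⟩ ⟨ζ', h', hf'⟩
    refine ⟨fun κ => ζ' (ζ κ), h.comp h', ?_⟩
    obtain ⟨e, hs, -⟩ := h
    have c0 : Tendsto (fun p : ℝ × ℝ × Vec ρ => ζ p.2.2) (𝓝 (t₀, x₀, S.κ₀)) (𝓝 S'.κ₀) := by
      have h3 : Tendsto ζ (𝓝 S.κ₀) (𝓝 S'.κ₀) := by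
        simpa [ContinuousAt, e] using hs.continuousAt
      exact h3.comp (Continuous.tendsto' (by fun_prop) _ _ rfl)
    have c1 : Tendsto (fun p : ℝ × ℝ × Vec ρ => (p.1, p.2.1, ζ p.2.2)) (𝓝 (t₀, x₀, S.κ₀))
        (𝓝 (t₀, x₀, S'.κ₀)) :=
      (Continuous.tendsto' (by fun_prop) _ _ rfl).prodMk_nhds
        ((Continuous.tendsto' (by fun_prop) _ _ rfl).prodMk_nhds c0)
    filter_upwards [c1.eventually hf', hf] with p k1 k2
    rw [k1, k2]

theorem Ansatz.equivalence :
    Equivalence (Ansatz.Equivalent (ρ := ρ) (t₀ := t₀) (x₀ := x₀)) where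
  refl A := ⟨fun _ c => c, IsTimeReparam.refl _ _, Eventually.of_forall fun _ => rfl⟩
  symm := by
    rintro A A' ⟨ζ, ⟨e, hs, ξ, hξ, h1, h2⟩, hf⟩
    have e1 : ξ t₀ A'.c₀ = A.c₀ := by rw [← e]; exact h1.self_of_nhds
    refine ⟨ξ, ⟨e1, hξ, ζ, hs, h2, h1⟩, ?_⟩
    have c2 : Tendsto (fun p : ℝ × ℝ × Vec ρ => (p.1, p.2.2)) (𝓝 (t₀, x₀, A'.c₀))
        (𝓝 (t₀, A'.c₀)) := Continuous.tendsto' (by fun_prop) _ _ rfl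
    have c0 : Tendsto (fun p : ℝ × ℝ × Vec ρ => ξ p.1 p.2.2) (𝓝 (t₀, x₀, A'.c₀))
        (𝓝 A.c₀) := by
      have h3 : Tendsto (fun p : ℝ × Vec ρ => ξ p.1 p.2) (𝓝 (t₀, A'.c₀)) (𝓝 A.c₀) := by
        simpa [ContinuousAt, e1] using hξ.continuousAt
      exact h3.comp c2
    have c1 : Tendsto (fun p : ℝ × ℝ × Vec ρ => (p.1, p.2.1, ξ p.1 p.2.2)) (𝓝 (t₀, x₀, A'.c₀))
        (𝓝 (t₀, x₀, A.c₀)) :=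
      (Continuous.tendsto' (by fun_prop) _ _ rfl).prodMk_nhds
        ((Continuous.tendsto' (by fun_prop) _ _ rfl).prodMk_nhds c0)
    filter_upwards [c1.eventually hf, c2.eventually h2] with p k1 k2
    rw [← k1, k2]
  trans := by
    rintro A A' A'' ⟨ζ, h, hf⟩ ⟨ζ', h', hf'⟩
    refine ⟨fun t κ => ζ' t (ζ t κ), h.comp h', ?_⟩
    obtain ⟨e, hs, -⟩ := h
    have c2 : Tendsto (fun p : ℝ × ℝ × Vec ρ => (p.1, p.2.2)) (𝓝 (t₀, x₀, A.c₀))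
        (𝓝 (t₀, A.c₀)) := Continuous.tendsto' (by fun_prop) _ _ rfl
    have c0 : Tendsto (fun p : ℝ × ℝ × Vec ρ => ζ p.1 p.2.2) (𝓝 (t₀, x₀, A.c₀))
        (𝓝 A'.c₀) := by
      have h3 : Tendsto (fun p : ℝ × Vec ρ => ζ p.1 p.2) (𝓝 (t₀, A.c₀)) (𝓝 A'.c₀) := by
        simpa [ContinuousAt, e] using hs.continuousAt
      exact h3.comp c2
    have c1 : Tendsto (fun p : ℝ × ℝ × Vec ρ => (p.1, p.2.1, ζ p.1 p.2.2)) (𝓝 (t₀, x₀, A.c₀))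
        (𝓝 (t₀, x₀, A'.c₀)) :=
      (Continuous.tendsto' (by fun_prop) _ _ rfl).prodMk_nhds
        ((Continuous.tendsto' (by fun_prop) _ _ rfl).prodMk_nhds c0)
    filter_upwards [c1.eventually hf', hf] with p k1 k2
    rw [k1, k2]

end Equivalences

/-- Solution families up to re-parametrization. -/
def SolutionFamily.setoid (E : EvolEq) (ρ : ℕ) (t₀ x₀ : ℝ) :
    Setoid (SolutionFamily E ρ t₀ x₀) :=
  ⟨SolutionFamily.Equivalent, SolutionFamily.equivalence⟩

/-- Ansatzes up to equivalence. -/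
def Ansatz.setoid (ρ : ℕ) (t₀ x₀ : ℝ) : Setoid (Ansatz ρ t₀ x₀) :=
  ⟨Ansatz.Equivalent, Ansatz.equivalence⟩

/-- Ansatzes reducing `E`, up to equivalence of ansatzes. -/
def ReducingAnsatz.setoid (E : EvolEq) (ρ : ℕ) (t₀ x₀ : ℝ) :
    Setoid (ReducingAnsatz E ρ t₀ x₀) :=
  (Ansatz.setoid ρ t₀ x₀).comap Subtype.val

/-- The set of equivalence classes of `ρ`-parametric solution families of `E` near `(t₀, x₀)`. -/
abbrev SolutionFamilyClass (E : EvolEq) (ρ : ℕ) (t₀ x₀ : ℝ) : Type :=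
  Quotient (SolutionFamily.setoid E ρ t₀ x₀)

/-- The set of equivalence classes of ansatzes reducing `E` near `(t₀, x₀)`. -/
abbrev ReducingAnsatzClass (E : EvolEq) (ρ : ℕ) (t₀ x₀ : ℝ) : Type :=
  Quotient (ReducingAnsatz.setoid E ρ t₀ x₀)

end EvolAnsatz

end

/-! The correspondence sends a family `f(t, x, κ)` to itself, read as an ansatz. Three facts make
this a bijection on classes.

It is well defined because `Φ` is invertible for a family (`IsSolutionFamilyAt.det_ne_zero`).
Otherwise, by regularity, there is `k < ρ` such that the gradients `∇f_0, …, ∇f_{k-1}` in the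
parameters are independent near the point and `∇f_k` is a smooth combination of them. Their smooth
span is then closed under `∂_x`, so it contains every `∇f_j`. It is also closed under `∂_t`, because
the equation gives `∇f_t = ∑ H_{u_j} ∇f_j`. By Grönwall, a parameter direction annihilated by the
span at `(t₀, x₀, κ)` is annihilated at `(t, x, κ)`. Hence `f` depends on `κ` only through the `k`
functions `f_i(t₀, x₀, κ)`, `i < k`, and the parameters are not essential.

If `F(t, x, ζ(t, κ)) = f(t, x, κ)`, then applying `∂_x^i` to the equation, `i < ρ`, gives `Φ ζ_t =
∂_x^i (H̃ - F_t)`. So for a reducing `F` an equivalence of ansatzes from `f` to `F` is the same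
thing as a general solution of the reduced system (`SolutionFamily.equivalent_iff_isObtainedFrom`).
When `F` is itself a family, the reduced system is `φ_t = 0`; then `ζ` does not depend on `t` and is
an equivalence of families. This is injectivity.

For surjectivity the reduced system is solved with smooth dependence on initial data
(`exists_generalSolution`) and the solution is substituted into `F`. The Jacobian of the result is
`Φ · ∂ψ/∂κ`, whose invertibility implies both essential parameters and regularity. Smoothness of the
flow comes from the inverse function theorem in the Banach space of continuous curves.

Density of regular points is lower semicontinuity of rank: a point of a given open set where the sum
of the ranks is maximal is regular. -/

noncomputable section

namespace EvolAnsatz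

/-! ### Smooth germs and iterated directional derivatives -/

section SmoothCalculus

variable {V W X : Type*} [NormedAddCommGroup V] [NormedSpace ℝ V]
  [NormedAddCommGroup W] [NormedSpace ℝ W] [NormedAddCommGroup X] [NormedSpace ℝ X]
  {g h : V → W} {p v w : V}

theorem SmoothNear.eventually (hg : SmoothNear g p) : ∀ᶠ q in 𝓝 p, SmoothNear g q :=
  eventually_eventually_nhds.2 hg

theorem SmoothNear.contDiffAt (hg : SmoothNear g p) : ContDiffAt ℝ ∞ g p := hg.self_of_nhds

theorem SmoothNear.differentiableAt (hg : SmoothNear g p) : DifferentiableAt ℝ g p :=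
  hg.contDiffAt.differentiableAt (by simp)

theorem SmoothNear.congr (hg : SmoothNear g p) (e : h =ᶠ[𝓝 p] g) : SmoothNear h p := by
  filter_upwards [hg, eventually_eventually_nhds.2 e] with q hq hq'
  exact hq.congr_of_eventuallyEq hq'

theorem smoothNear_of_contDiff (hg : ContDiff ℝ ∞ g) : SmoothNear g p :=
  Eventually.of_forall fun _ => hg.contDiffAt

theorem smoothNear_const (c : W) : SmoothNear (fun _ : V => c) p :=
  smoothNear_of_contDiff contDiff_const

theorem smoothNear_of_isOpen {s : Set V} (hs : IsOpen s) (hg : ContDiffOn ℝ ∞ g s) (hp : p ∈ s) :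
    SmoothNear g p := by
  filter_upwards [hs.mem_nhds hp] with q hq
  exact hg.contDiffAt (hs.mem_nhds hq)

theorem SmoothNear.add (hg : SmoothNear g p) (hh : SmoothNear h p) :
    SmoothNear (fun q => g q + h q) p := by
  filter_upwards [hg, hh] with q h1 h2 using h1.add h2

theorem SmoothNear.sub (hg : SmoothNear g p) (hh : SmoothNear h p) :
    SmoothNear (fun q => g q - h q) p := by
  filter_upwards [hg, hh] with q h1 h2 using h1.sub h2

theorem SmoothNear.smul {a : V → ℝ} (ha : SmoothNear a p) (hh : SmoothNear h p) :
    SmoothNear (fun q => a q • h q) p := by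
  filter_upwards [ha, hh] with q h1 h2 using h1.smul h2

theorem SmoothNear.mul {a b : V → ℝ} (ha : SmoothNear a p) (hb : SmoothNear b p) :
    SmoothNear (fun q => a q * b q) p := by
  filter_upwards [ha, hb] with q h1 h2 using h1.mul h2

theorem SmoothNear.inv {a : V → ℝ} (ha : SmoothNear a p) (h0 : a p ≠ 0) :
    SmoothNear (fun q => (a q)⁻¹) p := by
  filter_upwards [ha, ha.continuousAt.eventually_ne h0] with q h1 h2 using h1.inv h2

theorem SmoothNear.sum {ι : Type*} {s : Finset ι} {a : ι → V → W}
    (ha : ∀ i ∈ s, SmoothNear (a i) p) : SmoothNear (fun q => ∑ i ∈ s, a i q) p := by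
  filter_upwards [(eventually_all_finset s).2 ha] with q hq using ContDiffAt.sum hq

theorem SmoothNear.prod {ι : Type*} {s : Finset ι} {a : ι → V → ℝ}
    (ha : ∀ i ∈ s, SmoothNear (a i) p) : SmoothNear (fun q => ∏ i ∈ s, a i q) p := by
  filter_upwards [(eventually_all_finset s).2 ha] with q hq using contDiffAt_prod hq

theorem SmoothNear.prodMk {k : V → X} (hg : SmoothNear g p) (hk : SmoothNear k p) :
    SmoothNear (fun q => (g q, k q)) p := by
  filter_upwards [hg, hk] with q h1 h2 using h1.prodMk h2

theorem smoothNear_pi {ι : Type*} [Fintype ι] {a : V → ι → W} :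
    SmoothNear a p ↔ ∀ i, SmoothNear (fun q => a q i) p := by
  simp only [SmoothNear, contDiffAt_pi, eventually_all]

theorem SmoothNear.fderiv (hg : SmoothNear g p) : SmoothNear (fderiv ℝ g) p := by
  filter_upwards [hg] with q hq using hq.fderiv_right (m := ∞) (by simp)

theorem SmoothNear.clm_comp_left (L : W →L[ℝ] X) (hg : SmoothNear g p) :
    SmoothNear (fun q => L (g q)) p := by
  filter_upwards [hg] with q hq using L.contDiff.contDiffAt.comp q hq

/-- The derivative of `g` in the direction `v`. -/
def dirD (v : V) (g : V → W) : V → W := fun p => _root_.fderiv ℝ g p v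

theorem SmoothNear.dirD (v : V) (hg : SmoothNear g p) : SmoothNear (dirD v g) p := by
  filter_upwards [hg.fderiv] with q hq using hq.clm_apply contDiffAt_const

theorem SmoothNear.iterate_dirD (v : V) (k : ℕ) (hg : SmoothNear g p) :
    SmoothNear ((EvolAnsatz.dirD v)^[k] g) p := by
  induction k with
  | zero => exact hg
  | succ k ih => rw [Function.iterate_succ_apply']; exact ih.dirD v

theorem dirD_congr (v : V) (e : g =ᶠ[𝓝 p] h) : dirD v g =ᶠ[𝓝 p] dirD v h := by
  filter_upwards [eventually_eventually_nhds.2 e] with q hq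
  simp only [dirD, EventuallyEq.fderiv_eq hq]

theorem iterate_dirD_congr (v : V) (k : ℕ) (e : g =ᶠ[𝓝 p] h) :
    (dirD v)^[k] g =ᶠ[𝓝 p] (dirD v)^[k] h := by
  induction k with
  | zero => exact e
  | succ k ih => simpa only [Function.iterate_succ_apply'] using dirD_congr v ih

theorem fderiv_dirD (hg : SmoothNear g p) :
    fderiv ℝ (dirD v g) p w = fderiv ℝ (fderiv ℝ g) p w v := by
  have h1 : DifferentiableAt ℝ (fderiv ℝ g) p := hg.fderiv.differentiableAt
  have h2 := (h1.hasFDerivAt.clm_apply (hasFDerivAt_const v p)).fderiv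
  have : fderiv ℝ (dirD v g) p = _ := h2
  rw [this]; simp

theorem dirD_comm (v w : V) (hg : SmoothNear g p) :
    dirD v (dirD w g) =ᶠ[𝓝 p] dirD w (dirD v g) := by
  filter_upwards [hg.eventually] with q hq
  have hs : IsSymmSndFDerivAt ℝ g q :=
    hq.contDiffAt.isSymmSndFDerivAt (by simpa using WithTop.coe_le_coe.2 (le_top : (2 : ℕ∞) ≤ ⊤))
  change fderiv ℝ (dirD w g) q v = fderiv ℝ (dirD v g) q w
  rw [fderiv_dirD hq, fderiv_dirD hq, hs.eq]

theorem dirD_iterate_comm (v w : V) (k : ℕ) (hg : SmoothNear g p) :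
    dirD v ((dirD w)^[k] g) =ᶠ[𝓝 p] (dirD w)^[k] (dirD v g) := by
  induction k with
  | zero => exact EventuallyEq.rfl
  | succ k ih =>
    simp only [Function.iterate_succ_apply']
    exact (dirD_comm v w (hg.iterate_dirD w k)).trans (dirD_congr w ih)

theorem iterate_dirD_add (v : V) (k : ℕ) (hg : SmoothNear g p) (hh : SmoothNear h p) :
    (dirD v)^[k] (fun q => g q + h q) =ᶠ[𝓝 p]
      fun q => (dirD v)^[k] g q + (dirD v)^[k] h q := by
  induction k with
  | zero => exact EventuallyEq.rfl
  | succ k ih =>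
    simp only [Function.iterate_succ_apply']
    refine (dirD_congr v ih).trans ?_
    filter_upwards [(hg.iterate_dirD v k).eventually, (hh.iterate_dirD v k).eventually] with q h1 h2
    simp only [dirD]
    rw [fderiv_fun_add h1.differentiableAt h2.differentiableAt]; rfl

end SmoothCalculus

/-! ### Partial derivatives in `t`, `x` and the parameters as directional derivatives -/

section Uncurried

variable {ρ : ℕ} {f f' : ℝ → ℝ → Vec ρ → ℝ} {p : ℝ × ℝ × Vec ρ}

/-- The function of the point `(t, x, c)` given by a function `f(t, x, c)`. -/
def unc (f : ℝ → ℝ → Vec ρ → ℝ) : ℝ × ℝ × Vec ρ → ℝ := fun p => f p.1 p.2.1 p.2.2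

/-- The direction of the variable `t`. -/
def eT : ℝ × ℝ × Vec ρ := (1, 0, 0)

/-- The direction of the variable `x`. -/
def eX : ℝ × ℝ × Vec ρ := (0, 1, 0)

/-- The inclusion of the directions of the parameters. -/
def inC : Vec ρ →L[ℝ] ℝ × ℝ × Vec ρ :=
  (ContinuousLinearMap.inr ℝ ℝ (ℝ × Vec ρ)).comp (ContinuousLinearMap.inr ℝ ℝ (Vec ρ))

@[simp] theorem inC_apply (v : Vec ρ) : inC v = ((0, 0, v) : ℝ × ℝ × Vec ρ) := rfl

theorem deriv_slice_x {W : Type*} [NormedAddCommGroup W] [NormedSpace ℝ W]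
    {g : ℝ × ℝ × Vec ρ → W} (hg : DifferentiableAt ℝ g p) :
    HasDerivAt (fun y => g (p.1, y, p.2.2)) (dirD eX g p) p.2.1 := by
  have h : HasDerivAt (fun y : ℝ => ((p.1, y, p.2.2) : ℝ × ℝ × Vec ρ)) eX p.2.1 :=
    (hasDerivAt_const _ _).prodMk ((hasDerivAt_id _).prodMk (hasDerivAt_const _ _))
  exact hg.hasFDerivAt.comp_hasDerivAt_of_eq p.2.1 h rfl

theorem deriv_slice_t {W : Type*} [NormedAddCommGroup W] [NormedSpace ℝ W]
    {g : ℝ × ℝ × Vec ρ → W} (hg : DifferentiableAt ℝ g p) :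
    HasDerivAt (fun y => g (y, p.2.1, p.2.2)) (dirD eT g p) p.1 := by
  have h : HasDerivAt (fun y : ℝ => ((y, p.2.1, p.2.2) : ℝ × ℝ × Vec ρ)) eT p.1 :=
    (hasDerivAt_id _).prodMk ((hasDerivAt_const _ _).prodMk (hasDerivAt_const _ _))
  exact hg.hasFDerivAt.comp_hasDerivAt_of_eq p.1 h rfl

theorem fderiv_slice_c {W : Type*} [NormedAddCommGroup W] [NormedSpace ℝ W]
    {g : ℝ × ℝ × Vec ρ → W} (hg : DifferentiableAt ℝ g p) :
    HasFDerivAt (fun c => g (p.1, p.2.1, c)) ((fderiv ℝ g p).comp inC) p.2.2 := by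
  have h : HasFDerivAt (fun c => ((p.1, p.2.1, c) : ℝ × ℝ × Vec ρ)) inC p.2.2 := by
    have h1 : HasFDerivAt (fun c : Vec ρ => ((0, 0, c) : ℝ × ℝ × Vec ρ)) inC p.2.2 :=
      inC.hasFDerivAt
    simpa using h1.const_add ((p.1, p.2.1, 0) : ℝ × ℝ × Vec ρ)
  exact HasFDerivAt.comp (g := g) p.2.2 hg.hasFDerivAt h

theorem unc_dx_succ (k : ℕ) (p : ℝ × ℝ × Vec ρ) :
    unc (dx (k + 1) f) p = deriv (fun y => unc (dx k f) (p.1, y, p.2.2)) p.2.1 := by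
  simp only [unc, dx, iteratedDeriv_succ]

/-- Bridge from one-variable derivatives on slices to directional derivatives on the whole space,
where symmetry of second derivatives is available. -/
theorem unc_dx (k : ℕ) (hf : SmoothNear (unc f) p) :
    unc (dx k f) =ᶠ[𝓝 p] (dirD eX)^[k] (unc f) := by
  induction k with
  | zero => exact Eventually.of_forall fun q => by simp [unc, dx]
  | succ k ih =>
    filter_upwards [eventually_eventually_nhds.2 ih, (hf.iterate_dirD eX k).eventually]
      with q h1 h2
    rw [unc_dx_succ, Function.iterate_succ_apply']
    have h3 : DifferentiableAt ℝ (unc (dx k f)) q := h2.differentiableAt.congr_of_eventuallyEq h1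
    rw [(deriv_slice_x h3).deriv]
    exact (dirD_congr eX h1).self_of_nhds

theorem SmoothNear.dx (k : ℕ) (hf : SmoothNear (unc f) p) : SmoothNear (unc (dx k f)) p :=
  (hf.iterate_dirD eX k).congr (unc_dx k hf)

theorem unc_dt (hf : SmoothNear (unc f) p) : unc (dt f) =ᶠ[𝓝 p] dirD eT (unc f) := by
  filter_upwards [hf.eventually] with q hq
  exact (deriv_slice_t hq.differentiableAt).deriv

theorem SmoothNear.dt (hf : SmoothNear (unc f) p) : SmoothNear (unc (dt f)) p :=
  (hf.dirD eT).congr (unc_dt hf)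

theorem tendsto_slice_x (p : ℝ × ℝ × Vec ρ) :
    Tendsto (fun y => ((p.1, y, p.2.2) : ℝ × ℝ × Vec ρ)) (𝓝 p.2.1) (𝓝 p) :=
  Continuous.tendsto' (by fun_prop) _ _ rfl

theorem tendsto_slice_t (p : ℝ × ℝ × Vec ρ) :
    Tendsto (fun y => ((y, p.2.1, p.2.2) : ℝ × ℝ × Vec ρ)) (𝓝 p.1) (𝓝 p) :=
  Continuous.tendsto' (by fun_prop) _ _ rfl

theorem tendsto_slice_c (p : ℝ × ℝ × Vec ρ) :
    Tendsto (fun c => ((p.1, p.2.1, c) : ℝ × ℝ × Vec ρ)) (𝓝 p.2.2) (𝓝 p) :=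
  Continuous.tendsto' (by fun_prop) _ _ rfl

theorem dx_eq_of_eventuallyEq (k : ℕ) (e : unc f =ᶠ[𝓝 p] unc f') :
    dx k f p.1 p.2.1 p.2.2 = dx k f' p.1 p.2.1 p.2.2 :=
  EventuallyEq.iteratedDeriv_eq k ((tendsto_slice_x p).eventually e)

theorem unc_dx_congr (k : ℕ) (e : unc f =ᶠ[𝓝 p] unc f') :
    unc (dx k f) =ᶠ[𝓝 p] unc (dx k f') := by
  filter_upwards [eventually_eventually_nhds.2 e] with q hq using dx_eq_of_eventuallyEq k hq

theorem unc_dt_congr (e : unc f =ᶠ[𝓝 p] unc f') :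
    unc (dt f) =ᶠ[𝓝 p] unc (dt f') := by
  filter_upwards [eventually_eventually_nhds.2 e] with q hq
  exact EventuallyEq.deriv_eq ((tendsto_slice_t q).eventually hq)

theorem xJet_eventuallyEq (r : ℕ) (e : unc f =ᶠ[𝓝 p] unc f') :
    ∀ᶠ q in 𝓝 p, xJet r f q.1 q.2.1 q.2.2 = xJet r f' q.1 q.2.1 q.2.2 := by
  filter_upwards [eventually_eventually_nhds.2 e] with q hq
  simp only [xJet, Prod.mk.injEq, true_and]
  exact funext fun k => dx_eq_of_eventuallyEq _ hq

theorem xJacobian_eventuallyEq (k : ℕ) (e : unc f =ᶠ[𝓝 p] unc f') :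
    ∀ᶠ q in 𝓝 p, xJacobian k f q.1 q.2.1 q.2.2 = xJacobian k f' q.1 q.2.1 q.2.2 := by
  filter_upwards [eventually_eventually_nhds.2 e] with q hq
  ext i b
  simp only [xJacobian, Matrix.of_apply]
  have h : (fun c' => dx i f q.1 q.2.1 c') =ᶠ[𝓝 q.2.2] fun c' => dx i f' q.1 q.2.1 c' :=
    (tendsto_slice_c q).eventually (unc_dx_congr i hq)
  rw [h.fderiv_eq]

theorem SmoothNear.xJet (r : ℕ) (hf : SmoothNear (unc f) p) :
    SmoothNear (fun q : ℝ × ℝ × Vec ρ => xJet r f q.1 q.2.1 q.2.2) p := by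
  refine (smoothNear_of_contDiff contDiff_fst).prodMk
    ((smoothNear_of_contDiff contDiff_snd.fst).prodMk (smoothNear_pi.2 fun i => ?_))
  exact hf.dx i

/-- The gradient with respect to the parameters. -/
def gradC (g : ℝ × ℝ × Vec ρ → ℝ) : ℝ × ℝ × Vec ρ → (Vec ρ →L[ℝ] ℝ) :=
  fun q => (fderiv ℝ g q).comp inC

theorem gradC_apply (g : ℝ × ℝ × Vec ρ → ℝ) (q : ℝ × ℝ × Vec ρ) (v : Vec ρ) :
    gradC g q v = dirD (inC v) g q := rfl

theorem gradC_congr {g h : ℝ × ℝ × Vec ρ → ℝ} (e : g =ᶠ[𝓝 p] h) :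
    gradC g =ᶠ[𝓝 p] gradC h := by
  filter_upwards [eventually_eventually_nhds.2 e] with q hq
  simp only [gradC, EventuallyEq.fderiv_eq hq]

theorem SmoothNear.gradC {g : ℝ × ℝ × Vec ρ → ℝ} (hg : SmoothNear g p) :
    SmoothNear (gradC g) p := by
  filter_upwards [hg.fderiv] with q hq using hq.clm_comp contDiffAt_const

theorem dirD_gradC (v : ℝ × ℝ × Vec ρ) {g : ℝ × ℝ × Vec ρ → ℝ} (hg : SmoothNear g p) :
    dirD v (gradC g) =ᶠ[𝓝 p] gradC (dirD v g) := by
  filter_upwards [hg.eventually] with q hq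
  ext1 w
  have h1 : HasFDerivAt (fun q => gradC g q w) ((fderiv ℝ (gradC g) q).flip w) q := by
    have := hq.gradC.differentiableAt.hasFDerivAt.clm_apply (hasFDerivAt_const w q)
    simpa using this
  rw [gradC_apply]
  have h2 : dirD v (dirD (inC w) g) q = dirD (inC w) (dirD v g) q :=
    (dirD_comm v (inC w) hq).self_of_nhds
  rw [← h2]
  exact (congrArg (· v) h1.fderiv).symm

theorem xJacobian_apply_eventually (k : ℕ) (hf : SmoothNear (unc f) p) :
    ∀ᶠ q in 𝓝 p, ∀ (i : Fin k) b, xJacobian k f q.1 q.2.1 q.2.2 i b =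
      gradC ((dirD eX)^[i] (unc f)) q (Pi.single b 1) := by
  filter_upwards [eventually_all.2 fun i : Fin k => gradC_congr (unc_dx i hf),
    hf.eventually] with q h1 h2 i b
  rw [← h1 i]
  exact congrArg (· (Pi.single b 1)) (fderiv_slice_c (h2.dx i).differentiableAt).fderiv

theorem SmoothNear.xJacobian (k : ℕ) (hf : SmoothNear (unc f) p) (i : Fin k) (b : Fin ρ) :
    SmoothNear (fun q : ℝ × ℝ × Vec ρ => xJacobian k f q.1 q.2.1 q.2.2 i b) p := by
  refine ((hf.iterate_dirD eX i).dirD (inC (Pi.single b 1))).congr ?_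
  filter_upwards [xJacobian_apply_eventually k hf] with q hq using hq i b

end Uncurried

/-! ### Smooth dependence of determinants and inverse matrices -/

section Matrices

variable {V : Type*} [NormedAddCommGroup V] [NormedSpace ℝ V] {p : V}
  {m : Type*} [Fintype m] [DecidableEq m]

theorem smoothNear_det {A : V → Matrix m m ℝ} (hA : ∀ i j, SmoothNear (fun q => A q i j) p) :
    SmoothNear (fun q => (A q).det) p := by
  simp only [Matrix.det_apply']
  exact SmoothNear.sum fun σ _ => (smoothNear_const _).mul (SmoothNear.prod fun i _ => hA _ _)

theorem smoothNear_inv {A : V → Matrix m m ℝ} (hA : ∀ i j, SmoothNear (fun q => A q i j) p)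
    (h0 : (A p).det ≠ 0) (i j : m) : SmoothNear (fun q => (A q)⁻¹ i j) p := by
  simp only [Matrix.inv_def, Matrix.smul_apply, Ring.inverse_eq_inv', Matrix.adjugate_apply]
  refine ((smoothNear_det hA).inv h0).smul (smoothNear_det fun k l => ?_)
  simp only [Matrix.updateRow_apply]
  split_ifs
  · exact smoothNear_const _
  · exact hA _ _

end Matrices

/-! ### Superposition operators on spaces of continuous functions -/

section Superposition

variable {K : Type} [TopologicalSpace K] [CompactSpace K]
  {V W : Type} [NormedAddCommGroup V] [NormedSpace ℝ V] [NormedAddCommGroup W] [NormedSpace ℝ W]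

/-- Pointwise application of a continuous operator-valued map to a continuous vector-valued map. -/
def pointwiseApply : C(K, V →L[ℝ] W) →L[ℝ] C(K, V) →L[ℝ] C(K, W) :=
  LinearMap.mkContinuous₂
    (LinearMap.mk₂ ℝ (fun (A : C(K, V →L[ℝ] W)) (γ : C(K, V)) =>
        (⟨fun s => A s (γ s), by fun_prop⟩ : C(K, W)))
      (fun A B γ => by ext; simp) (fun c A γ => by ext; simp)
      (fun A γ δ => by ext; simp) (fun c A γ => by ext; simp)) 1
    fun A γ => by
      rw [one_mul, ContinuousMap.norm_le _ (by positivity)]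
      intro s
      exact ((A s).le_opNorm _).trans
        (mul_le_mul (A.norm_coe_le_norm s) (γ.norm_coe_le_norm s) (by positivity) (by positivity))

/-- The values of `γ` lie in a compact ball, on a neighbourhood of which `fderiv ℝ g` is uniformly
continuous. The mean value inequality then bounds the remainder by `ε ‖h‖` at all points of `K` at
once. -/
theorem hasFDerivAt_superposition [ProperSpace V] {g : V → W} (hg : ContDiff ℝ 1 g)
    (γ : C(K, V)) :
    HasFDerivAt (fun η : C(K, V) => (⟨g, hg.continuous⟩ : C(V, W)).comp η)
      (pointwiseApply ((⟨fderiv ℝ g, hg.continuous_fderiv (by simp)⟩ :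
        C(V, V →L[ℝ] W)).comp γ)) γ := by
  rw [hasFDerivAt_iff_isLittleO_nhds_zero, Asymptotics.isLittleO_iff]
  intro ε hε
  have hc : UniformContinuousOn (fderiv ℝ g) (Metric.closedBall 0 (‖γ‖ + 1)) :=
    (isCompact_closedBall _ _).uniformContinuousOn_of_continuous
      (hg.continuous_fderiv (by simp)).continuousOn
  obtain ⟨δ, hδ, H⟩ := Metric.uniformContinuousOn_iff.1 hc ε hε
  filter_upwards [Metric.ball_mem_nhds (0 : C(K, V)) (lt_min hδ one_pos)] with h hh
  rw [mem_ball_zero_iff, lt_min_iff] at hh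
  rw [ContinuousMap.norm_le _ (by positivity)]
  intro s
  have hs : ‖h s‖ ≤ ‖h‖ := h.norm_coe_le_norm s
  have hγ : ‖γ s‖ ≤ ‖γ‖ := γ.norm_coe_le_norm s
  have key := (convex_ball (γ s) (min δ 1)).norm_image_sub_le_of_norm_hasFDerivWithin_le'
    (f := g) (f' := fderiv ℝ g) (φ := fderiv ℝ g (γ s)) (C := ε) (x := γ s) (y := γ s + h s)
    (fun z _ => (hg.differentiable (by simp) z).hasFDerivAt.hasFDerivWithinAt)
    (fun z hz => by
      rw [Metric.mem_ball, lt_min_iff] at hz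
      refine (dist_eq_norm (fderiv ℝ g z) (fderiv ℝ g (γ s))).symm.trans_le (H z ?_ _ ?_ hz.1).le
      · rw [mem_closedBall_zero_iff]
        have := norm_le_norm_add_norm_sub' z (γ s)
        rw [← dist_eq_norm] at this
        linarith [hz.2]
      · rw [mem_closedBall_zero_iff]; linarith)
    (Metric.mem_ball_self (lt_min hδ one_pos))
    (by rw [mem_ball_iff_norm, add_sub_cancel_left, lt_min_iff]
        exact ⟨hs.trans_lt hh.1, hs.trans_lt hh.2⟩)
  rw [add_sub_cancel_left] at key
  exact key.trans (by gcongr)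

/-- The derivative is the superposition operator of `fderiv ℝ g` followed by a bounded linear map,
so induction on `n` applies. The target `W` is quantified inside because it becomes `V →L[ℝ] W` at
each step. -/
theorem contDiff_superposition [ProperSpace V] (n : ℕ) : ∀ {W : Type} [NormedAddCommGroup W]
    [NormedSpace ℝ W] {g : V → W} (hg : ContDiff ℝ ∞ g),
    ContDiff ℝ n (fun η : C(K, V) => (⟨g, hg.continuous⟩ : C(V, W)).comp η) := by
  induction n with
  | zero =>
    intro W _ _ g hg
    exact contDiff_zero.2 (ContinuousMap.continuous_postcomp _)
  | succ n ih =>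
    intro W _ _ g hg
    have hd : ContDiff ℝ ∞ (fderiv ℝ g) := hg.fderiv_right (by simp)
    have h1 : ContDiff ℝ 1 g := hg.of_le (mod_cast le_top)
    refine contDiff_succ_iff_hasFDerivAt.2 ⟨_, ?_, fun γ => hasFDerivAt_superposition h1 γ⟩
    exact pointwiseApply.contDiff.comp (ih hd)

theorem contDiff_infty_superposition [ProperSpace V] {g : V → W} (hg : ContDiff ℝ ∞ g) :
    ContDiff ℝ ∞ (fun η : C(K, V) => (⟨g, hg.continuous⟩ : C(V, W)).comp η) :=
  contDiff_infty.2 fun n => contDiff_superposition n hg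

end Superposition

/-! ### Smooth local inverses -/

section InverseFunction

variable {V W : Type*} [NormedAddCommGroup V] [NormedSpace ℝ V] [CompleteSpace V]
  [NormedAddCommGroup W] [NormedSpace ℝ W]

theorem SmoothNear.exists_localInverse {f : V → W} {a : V} (hf : SmoothNear f a) {f' : V ≃L[ℝ] W}
    (hf' : HasFDerivAt f (f' : V →L[ℝ] W) a) :
    ∃ g : W → V, SmoothNear g (f a) ∧ g (f a) = a ∧ (∀ᶠ x in 𝓝 a, g (f x) = x) ∧
      ∀ᶠ y in 𝓝 (f a), f (g y) = y := by
  set e := hf.contDiffAt.toOpenPartialHomeomorph f hf' (by simp) with he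
  have hcoe : (e : V → W) = f := hf.contDiffAt.toOpenPartialHomeomorph_coe hf' (by simp)
  have ha : a ∈ e.source := hf.contDiffAt.mem_toOpenPartialHomeomorph_source hf' (by simp)
  have hfa : f a ∈ e.target := by simpa [hcoe] using e.map_source ha
  have hsymm : e.symm (f a) = a := by simpa [hcoe] using e.left_inv ha
  -- Smoothness of the inverse at nearby points needs an invertible derivative there; invertible
  -- operators form an open set.
  have hinv : ∀ᶠ x in 𝓝 a, _root_.fderiv ℝ f x ∈
      Set.range (ContinuousLinearEquiv.toContinuousLinearMap : (V ≃L[ℝ] W) → V →L[ℝ] W) := by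
    refine hf.fderiv.continuousAt.eventually_mem ?_
    rw [hf'.fderiv]
    exact f'.nhds
  have hcont : Tendsto e.symm (𝓝 (f a)) (𝓝 a) := by
    simpa [ContinuousAt, hsymm] using e.symm.continuousAt (x := f a) hfa
  refine ⟨e.symm, ?_, hsymm, ?_, ?_⟩
  · filter_upwards [e.open_target.mem_nhds hfa, hcont.eventually hinv, hcont.eventually hf,
      hcont.eventually hf.eventually] with y h1 ⟨L, hL⟩ h3 h4
    refine e.contDiffAt_symm (f₀' := L) h1 ?_ (by rwa [hcoe])
    rw [hcoe, hL]
    exact h4.differentiableAt.hasFDerivAt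
  · filter_upwards [e.open_source.mem_nhds ha] with x hx
    simpa [hcoe] using e.left_inv hx
  · filter_upwards [e.open_target.mem_nhds hfa] with y hy
    simpa [hcoe] using e.right_inv hy

end InverseFunction

theorem eventually_eq_of_hasDerivAt_zero {V W : Type*} [NormedAddCommGroup V]
    [NormedAddCommGroup W] [NormedSpace ℝ W] {g : ℝ → V → W} {t₀ : ℝ} {z₀ : V}
    (h : ∀ᶠ p in 𝓝 (t₀, z₀), HasDerivAt (fun s => g s p.2) 0 p.1) :
    ∀ᶠ p in 𝓝 (t₀, z₀), g p.1 p.2 = g t₀ p.2 := by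
  obtain ⟨ε, hε, H⟩ := Metric.eventually_nhds_iff_ball.1 h
  filter_upwards [Metric.ball_mem_nhds _ hε] with p hp
  rw [← ball_prod_same] at hp H
  refine Metric.isOpen_ball.is_const_of_deriv_eq_zero (convex_ball t₀ ε).isPreconnected
    (f := fun s => g s p.2)
    (fun s hs => (H (s, p.2) ⟨hs, hp.2⟩).differentiableAt.differentiableWithinAt)
    (fun s hs => (H (s, p.2) ⟨hs, hp.2⟩).deriv) hp.1 (Metric.mem_ball_self hε)

/-! ### The integral equation for curves, solved in a Banach space -/

section Flow

variable {V : Type} [NormedAddCommGroup V] [NormedSpace ℝ V]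

theorem continuous_projIcc_comp {V : Type} [TopologicalSpace V] (γ : C(unitInterval, V)) :
    Continuous fun s : ℝ => γ (Set.projIcc 0 1 zero_le_one s) := by fun_prop

/-- The indefinite integral from `0`, as an operator on functions on the unit interval. -/
def primitive : C(unitInterval, V) →L[ℝ] C(unitInterval, V) :=
  LinearMap.mkContinuous
    { toFun := fun γ =>
        ⟨fun s => ∫ σ in (0 : ℝ)..s, γ (Set.projIcc 0 1 zero_le_one σ),
          (intervalIntegral.continuous_primitive
            (fun a b => (continuous_projIcc_comp γ).intervalIntegrable a b) 0).comp
            continuous_subtype_val⟩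
      map_add' := fun γ δ => by
        ext s
        exact intervalIntegral.integral_add ((continuous_projIcc_comp γ).intervalIntegrable _ _)
          ((continuous_projIcc_comp δ).intervalIntegrable _ _)
      map_smul' := fun c γ => by
        ext s
        exact intervalIntegral.integral_smul _ _ } 1
    fun γ => by
      rw [one_mul, ContinuousMap.norm_le _ (norm_nonneg _)]
      intro s
      have h := intervalIntegral.norm_integral_le_of_norm_le_const
        (a := (0 : ℝ)) (b := s) (f := fun σ => γ (Set.projIcc 0 1 zero_le_one σ)) (C := ‖γ‖)
        (fun σ _ => γ.norm_coe_le_norm _)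
      refine h.trans (mul_le_of_le_one_right (norm_nonneg _) ?_)
      rw [sub_zero, abs_of_nonneg s.2.1]
      exact s.2.2

theorem primitive_apply (γ : C(unitInterval, V)) (s : unitInterval) :
    primitive γ s = ∫ σ in (0 : ℝ)..s, γ (Set.projIcc 0 1 zero_le_one σ) := rfl

/-- The curve `γ` run at a speed `l ≤ 1`. -/
def slowDown {V : Type} [TopologicalSpace V] (l : unitInterval)
    (γ : C(unitInterval, V)) : C(unitInterval, V) :=
  ⟨fun s => γ (l * s), by fun_prop⟩

@[simp] theorem slowDown_apply {V : Type} [TopologicalSpace V] (l : unitInterval)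
    (γ : C(unitInterval, V)) (s : unitInterval) :
    slowDown l γ s = γ (l * s) := rfl

/-- Change of variable `σ ↦ l σ`. It shows that slowing down a solution for `ε` gives a solution for
`l ε`. -/
theorem smul_primitive_slowDown (l s : unitInterval) (γ : C(unitInterval, V)) :
    (l : ℝ) • primitive (slowDown l γ) s = primitive γ (l * s) := by
  have h := intervalIntegral.smul_integral_comp_mul_left (a := 0) (b := (s : ℝ))
    (fun σ => γ (Set.projIcc 0 1 zero_le_one σ)) (l : ℝ)
  rw [mul_zero] at h
  rw [primitive_apply, primitive_apply, Set.Icc.coe_mul, ← h]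
  congr 1
  refine intervalIntegral.integral_congr fun σ hσ => ?_
  rw [Set.uIcc_of_le s.2.1] at hσ
  have h1 : σ ∈ Set.Icc (0 : ℝ) 1 := ⟨hσ.1, hσ.2.trans s.2.2⟩
  have h2 : (l : ℝ) * σ ∈ Set.Icc (0 : ℝ) 1 :=
    ⟨mul_nonneg l.2.1 h1.1, mul_le_one₀ l.2.2 h1.1 h1.2⟩
  simp only [slowDown_apply]
  rw [Set.projIcc_of_mem _ h1, Set.projIcc_of_mem _ h2]
  rfl

/-- The embedding of vectors as constant curves. -/
def constCurve : V →L[ℝ] C(unitInterval, V) :=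
  LinearMap.mkContinuous
    { toFun := fun v => ContinuousMap.const _ v
      map_add' := fun _ _ => rfl
      map_smul' := fun _ _ => rfl } 1
    fun v => by
      rw [one_mul, ContinuousMap.norm_le _ (norm_nonneg _)]
      exact fun _ => le_rfl

@[simp] theorem constCurve_apply (v : V) (s : unitInterval) : constCurve v s = v := rfl

variable [FiniteDimensional ℝ V]

/-- Curves which solve `γ' = ε w(γ)`, `γ(0) = z`, depend smoothly on `(ε, z)`. -/
theorem exists_smooth_curves {w : V → V} (hw : ContDiff ℝ ∞ w) (z₀ : V) :
    ∃ γ : ℝ × V → C(unitInterval, V), SmoothNear γ (0, z₀) ∧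
      (∀ᶠ p in 𝓝 ((0 : ℝ), z₀), γ p = constCurve p.2 +
        p.1 • primitive ((⟨w, hw.continuous⟩ : C(V, V)).comp (γ p))) ∧
      ∀ᶠ p in 𝓝 ((0 : ℝ), z₀), ∀ l : unitInterval, γ (l * p.1, p.2) = slowDown l (γ p) := by
  have : CompleteSpace V := FiniteDimensional.complete ℝ V
  have : ProperSpace V := FiniteDimensional.proper ℝ V
  set N : C(unitInterval, V) → C(unitInterval, V) :=
    fun η => (⟨w, hw.continuous⟩ : C(V, V)).comp η with hN
  have hNs : ContDiff ℝ ∞ N := contDiff_infty_superposition hw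
  set J : C(unitInterval, V) → C(unitInterval, V) := fun η => primitive (N η) with hJ
  have hJs : ContDiff ℝ ∞ J := (primitive (V := V)).contDiff.comp hNs
  -- The last component vanishes exactly on solutions of the integral equation. Keeping `(ε, z)` as
  -- the first component reduces the implicit function theorem to the inverse one.
  set T : (ℝ × V) × C(unitInterval, V) → (ℝ × V) × C(unitInterval, V) :=
    fun q => (q.1, q.2 - constCurve q.1.2 - q.1.1 • J q.2) with hT
  have hTs : ContDiff ℝ ∞ T := by fun_prop
  set a : (ℝ × V) × C(unitInterval, V) := ((0, z₀), constCurve z₀) with ha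
  have hTa : T a = ((0, z₀), 0) := by simp [hT, ha]
  set A : ℝ × V →L[ℝ] C(unitInterval, V) :=
    constCurve.comp (ContinuousLinearMap.snd ℝ ℝ V) +
      (ContinuousLinearMap.fst ℝ ℝ V).smulRight (J (constCurve z₀)) with hA
  -- At `ε = 0` the derivative of `J` drops out, so the differential is the identity minus the
  -- off-diagonal block `A`; its inverse has `+A`.
  let L : ((ℝ × V) × C(unitInterval, V)) ≃L[ℝ] (ℝ × V) × C(unitInterval, V) :=
    ContinuousLinearEquiv.equivOfInverse
      ((ContinuousLinearMap.fst ℝ _ _).prod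
        (ContinuousLinearMap.snd ℝ _ _ - A.comp (ContinuousLinearMap.fst ℝ _ _)))
      ((ContinuousLinearMap.fst ℝ _ _).prod
        (ContinuousLinearMap.snd ℝ _ _ + A.comp (ContinuousLinearMap.fst ℝ _ _)))
      (fun q => by simp) (fun q => by simp)
  have hL : HasFDerivAt T (L : (ℝ × V) × C(unitInterval, V) →L[ℝ] (ℝ × V) × C(unitInterval, V))
      a := by
    have h1 : HasFDerivAt (fun q : (ℝ × V) × C(unitInterval, V) => q.1)
        (ContinuousLinearMap.fst ℝ _ _) a := hasFDerivAt_fst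
    have h2 : HasFDerivAt (fun q : (ℝ × V) × C(unitInterval, V) => q.2)
        (ContinuousLinearMap.snd ℝ _ _) a := hasFDerivAt_snd
    have h3 : HasFDerivAt J (fderiv ℝ J a.2) a.2 :=
      (hJs.differentiable (by simp) _).hasFDerivAt
    have h4 := (h2.sub (constCurve.hasFDerivAt.comp a h1.snd)).sub
      (h1.fst.smul (h3.comp a h2))
    refine (h1.prodMk h4).congr_fderiv ?_
    ext q <;> simp [L, hA, ha, sub_sub]
  obtain ⟨g, hg, hga, hg1, hg2⟩ := (smoothNear_of_contDiff hTs (p := a)).exists_localInverse hL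
  rw [hTa] at hg hga hg2
  have hi : Tendsto (fun p : ℝ × V => (p, (0 : C(unitInterval, V)))) (𝓝 (0, z₀))
      (𝓝 ((0, z₀), 0)) := Continuous.tendsto' (by fun_prop) _ _ rfl
  have hγ : SmoothNear (fun p : ℝ × V => (g (p, 0)).2) (0, z₀) := by
    have h1 : SmoothNear (fun p : ℝ × V => g (p, 0)) (0, z₀) :=
      SmoothNear.comp (g := g) (f := fun p : ℝ × V => (p, (0 : C(unitInterval, V)))) hg
        (smoothNear_of_contDiff (by fun_prop))
    exact h1.clm_comp_left (ContinuousLinearMap.snd ℝ _ _)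
  have hsol : ∀ᶠ p in 𝓝 ((0 : ℝ), z₀), (g (p, 0)).2 = constCurve p.2 + p.1 • J (g (p, 0)).2 := by
    filter_upwards [hi.eventually hg2] with p hp
    simp only [hT, Prod.ext_iff] at hp
    have h1 : (g (p, 0)).1 = p := Prod.ext hp.1.1 hp.1.2
    have h2 := hp.2
    rw [h1, sub_sub, sub_eq_zero] at h2
    exact h2
  refine ⟨fun p => (g (p, 0)).2, hγ, hsol, ?_⟩
  obtain ⟨ε, hε, H⟩ := Metric.eventually_nhds_iff.1 hg1
  have hnear : ∀ᶠ p in 𝓝 ((0 : ℝ), z₀), dist (g (p, 0)).2 (constCurve z₀) < ε := by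
    have h0 : (g ((0, z₀), 0)).2 = constCurve z₀ := by rw [hga]
    have := hγ.continuousAt.eventually (Metric.ball_mem_nhds _ hε)
    simpa [h0] using this
  filter_upwards [hsol, hnear, Metric.ball_mem_nhds _ hε] with p hp1 hp2 hp3 l
  -- Local uniqueness: the slowed curve solves the equation for `l ε` and, having no values outside
  -- the range of the original curve, stays in the ball where `g` inverts `T`, for every `l` at
  -- once.
  have hq : dist ((((l : ℝ) * p.1, p.2), slowDown l (g (p, 0)).2) :
      (ℝ × V) × C(unitInterval, V)) a < ε := by
    rw [Metric.mem_ball, Prod.dist_eq, max_lt_iff] at hp3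
    rw [ha, Prod.dist_eq, Prod.dist_eq, max_lt_iff, max_lt_iff]
    refine ⟨⟨?_, hp3.2⟩, ?_⟩
    · refine lt_of_le_of_lt ?_ hp3.1
      simp only [Real.dist_eq, sub_zero, abs_mul, abs_of_nonneg l.2.1]
      exact mul_le_of_le_one_left (abs_nonneg _) l.2.2
    · rw [ContinuousMap.dist_lt_iff hε] at hp2 ⊢
      exact fun s => hp2 (l * s)
  have hTq : T (((l : ℝ) * p.1, p.2), slowDown l (g (p, 0)).2) = (((l : ℝ) * p.1, p.2), 0) := by
    simp only [hT, Prod.mk.injEq, true_and]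
    ext s
    have h1 : (g (p, 0)).2 (l * s) = p.2 + p.1 • J (g (p, 0)).2 (l * s) := by
      conv_lhs => rw [hp1]
      rfl
    have h2 : N (slowDown l (g (p, 0)).2) = slowDown l (N (g (p, 0)).2) := rfl
    have h3 := smul_primitive_slowDown l s (N (g (p, 0)).2)
    simp only [hJ, ContinuousMap.sub_apply, ContinuousMap.smul_apply, slowDown_apply, h2,
      constCurve_apply, ContinuousMap.zero_apply] at h1 ⊢
    rw [h1, mul_comm (l : ℝ), mul_smul, h3]
    abel
  have := H hq
  rw [hTq] at this
  rw [this]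

end Flow

/-! ### Smooth local flows and general solutions -/

section LocalFlow

variable {V : Type} [NormedAddCommGroup V] [NormedSpace ℝ V] [FiniteDimensional ℝ V]

/-- The flow is the endpoint `γ (ε, z) 1`. The scaling property identifies endpoints for smaller
times with interior points of a single curve, which turns the integral equation into a differential
equation in `ε`. -/
theorem exists_smooth_flow_of_contDiff {w : V → V} (hw : ContDiff ℝ ∞ w) (z₀ : V) :
    ∃ Φ : ℝ × V → V, SmoothNear Φ (0, z₀) ∧ (∀ᶠ z in 𝓝 z₀, Φ (0, z) = z) ∧
      ∀ᶠ p in 𝓝 ((0 : ℝ), z₀), HasDerivAt (fun s => Φ (s, p.2)) (w (Φ p)) p.1 := by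
  have : CompleteSpace V := FiniteDimensional.complete ℝ V
  have : ProperSpace V := FiniteDimensional.proper ℝ V
  obtain ⟨γ, hγ, hsol, hslow⟩ := exists_smooth_curves hw z₀
  set wc : C(V, V) := ⟨w, hw.continuous⟩ with hwc
  have hone : ∀ᶠ p in 𝓝 ((0 : ℝ), z₀), ∀ l : unitInterval, γ (l * p.1, p.2) 1 = γ p l := by
    filter_upwards [hslow] with p hp l
    rw [hp l, slowDown_apply, mul_one]
  have hz : Tendsto (fun z : V => ((0 : ℝ), z)) (𝓝 z₀) (𝓝 (0, z₀)) :=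
    Continuous.tendsto' (by fun_prop) _ _ rfl
  have hdbl : Tendsto (fun p : ℝ × V => (2 * p.1, p.2)) (𝓝 (0, z₀)) (𝓝 (0, z₀)) :=
    Continuous.tendsto' (by fun_prop) _ _ (by simp)
  have hzero : ∀ z, γ (0, z) = constCurve z + (0 : ℝ) • primitive (wc.comp (γ (0, z))) →
      γ (0, z) = constCurve z := fun z h => by rw [zero_smul, add_zero] at h; exact h
  refine ⟨fun p => γ p 1, ?_, ?_, ?_⟩
  · exact hγ.clm_comp_left (ContinuousMap.evalCLM ℝ (1 : unitInterval))
  · filter_upwards [hz.eventually hsol] with z h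
    rw [hzero z h, constCurve_apply]
  · filter_upwards [hdbl.eventually hsol, hdbl.eventually hone, hsol.eventually_nhds,
      hγ.eventually] with ⟨e, z⟩ h1 h2 h3 h4
    dsimp only at h1 h2 ⊢
    rcases eq_or_ne e 0 with rfl | he
    -- At time `0` the curve is constant and rescaling is impossible; here `z + s • P(s)` is
    -- differentiated with `P` differentiable and `P(0) = w z`.
    · have h5 : DifferentiableAt ℝ γ (0, z) := h4.differentiableAt
      have h6 : DifferentiableAt ℝ (fun s : ℝ => primitive (wc.comp (γ (s, z))) 1) 0 := by
        have a1 : DifferentiableAt ℝ (fun s : ℝ => γ (s, z)) 0 :=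
          DifferentiableAt.comp (g := γ) (0 : ℝ) h5 (by fun_prop)
        have a2 : DifferentiableAt ℝ (fun s : ℝ => wc.comp (γ (s, z))) 0 :=
          DifferentiableAt.comp (g := fun η : C(unitInterval, V) => wc.comp η) (0 : ℝ)
            ((contDiff_infty_superposition hw).differentiable (by simp) (γ (0, z))) a1
        have a3 : DifferentiableAt ℝ (fun s : ℝ => primitive (wc.comp (γ (s, z)))) 0 :=
          (primitive (V := V)).differentiableAt.comp (0 : ℝ) a2
        exact (ContinuousMap.evalCLM (M := V) ℝ (1 : unitInterval)).differentiableAt.comp (0 : ℝ) a3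
      have h7 := ((hasDerivAt_id (0 : ℝ)).smul h6.hasDerivAt).const_add z
      have h8 : γ (0, z) = constCurve z := hzero z h3.self_of_nhds
      have h9 : primitive (wc.comp (γ (0, z))) 1 = w z := by
        rw [h8, primitive_apply]
        simp [hwc]
      simp only [id, zero_smul, one_smul, zero_add, h9] at h7
      rw [h8, constCurve_apply]
      refine h7.congr_of_eventuallyEq ?_
      have : Tendsto (fun s : ℝ => (s, z)) (𝓝 0) (𝓝 ((0 : ℝ), z)) :=
        Continuous.tendsto' (by fun_prop) _ _ rfl
      filter_upwards [this.eventually h3] with s hs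
      conv_lhs => rw [hs]
      rfl
    -- The curve for the doubled time `2 e` is used so that `s` near `e` corresponds to parameters
    -- `s / (2 e)` near `1 / 2`, interior to the interval; the fundamental theorem of calculus
    -- applies there.
    · have h2e : (2 * e) ≠ 0 := by simpa using he
      set η := γ (2 * e, z) with hη
      set u : ℝ → V := fun s => wc.comp η (Set.projIcc 0 1 zero_le_one s) with hu
      have hcu : Continuous u := continuous_projIcc_comp (wc.comp η)
      have hint : HasDerivAt (fun l : ℝ => ∫ σ in (0 : ℝ)..l, u σ) (u (1 / 2)) (1 / 2) :=
        intervalIntegral.integral_hasDerivAt_right (hcu.intervalIntegrable _ _)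
          (hcu.stronglyMeasurableAtFilter _ _) hcu.continuousAt
      have hdiv : HasDerivAt (fun s : ℝ => s / (2 * e)) (1 / (2 * e)) e :=
        (hasDerivAt_id e).div_const _
      have hhalf : e / (2 * e) = 1 / 2 := by field_simp
      have h5 := (HasDerivAt.scomp_of_eq e hint hdiv hhalf.symm).const_smul (2 * e)
      have h6 := h5.const_add z
      have hval : (2 * e) • (1 / (2 * e)) • u (1 / 2) = u (1 / 2) := by
        rw [smul_smul, mul_one_div_cancel h2e, one_smul]
      have hmem : (1 / 2 : ℝ) ∈ Set.Icc (0 : ℝ) 1 := by norm_num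
      have hend : w (γ (e, z) 1) = u (1 / 2) := by
        have := h2 ⟨1 / 2, hmem⟩
        have he2 : (1 / 2 : ℝ) * (2 * e) = e := by ring
        simp only [he2] at this
        rw [this, hu]
        simp only [Set.projIcc_of_mem _ hmem]
        rfl
      rw [hval, ← hend] at h6
      refine h6.congr_of_eventuallyEq ?_
      have hnear : ∀ᶠ s in 𝓝 e, s / (2 * e) ∈ Set.Ioo (0 : ℝ) 1 := by
        refine hdiv.continuousAt.eventually_mem ?_
        rw [hhalf]
        exact Ioo_mem_nhds (by norm_num) (by norm_num)
      filter_upwards [hnear] with s hs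
      have h7 := h2 ⟨s / (2 * e), Set.Ioo_subset_Icc_self hs⟩
      have h8 : s / (2 * e) * (2 * e) = s := div_mul_cancel₀ _ h2e
      simp only [h8] at h7
      rw [h7]
      conv_lhs => rw [h1]
      rfl

/-- Cut-off by a bump function. The superposition operator is defined only for a globally smooth
field. -/
theorem exists_contDiff_eventuallyEq {w : V → V} {z₀ : V} (hw : SmoothNear w z₀) :
    ∃ w' : V → V, ContDiff ℝ ∞ w' ∧ w' =ᶠ[𝓝 z₀] w := by
  obtain ⟨ε, hε, H⟩ := Metric.eventually_nhds_iff_ball.1 hw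
  let b : ContDiffBump z₀ := ⟨ε / 4, ε / 2, by positivity, by linarith⟩
  refine ⟨fun z => b z • w z, ?_, ?_⟩
  · refine contDiff_iff_contDiffAt.2 fun z => ?_
    by_cases hz : z ∈ tsupport b
    · rw [b.tsupport_eq] at hz
      exact b.contDiffAt.smul (H z (Metric.closedBall_subset_ball (half_lt_self hε) hz))
    · refine (contDiffAt_const (c := (0 : V))).congr_of_eventuallyEq ?_
      filter_upwards [notMem_tsupport_iff_eventuallyEq.1 hz] with y hy
      simp [hy]
  · filter_upwards [b.eventuallyEq_one] with z hz
    simp [hz]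

/-- The local flow of a smooth vector field is smooth. -/
theorem exists_smooth_flow {w : V → V} {z₀ : V} (hw : SmoothNear w z₀) :
    ∃ Φ : ℝ × V → V, SmoothNear Φ (0, z₀) ∧ (∀ᶠ z in 𝓝 z₀, Φ (0, z) = z) ∧
      ∀ᶠ p in 𝓝 ((0 : ℝ), z₀), HasDerivAt (fun s => Φ (s, p.2)) (w (Φ p)) p.1 := by
  obtain ⟨w', hw', he⟩ := exists_contDiff_eventuallyEq hw
  obtain ⟨Φ, h1, h2, h3⟩ := exists_smooth_flow_of_contDiff hw' z₀
  refine ⟨Φ, h1, h2, ?_⟩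
  have h4 : Tendsto Φ (𝓝 (0, z₀)) (𝓝 z₀) := by
    simpa [ContinuousAt, h2.self_of_nhds] using h1.continuousAt
  filter_upwards [h3, h4.eventually he] with p h5 h6
  rwa [← h6]

/-- A smooth time-dependent system has a smooth general solution, parametrized by the values at
the initial time. -/
theorem exists_generalSolution {ρ : ℕ} {G : ℝ → Vec ρ → Vec ρ} {t₀ : ℝ} {c₀ : Vec ρ}
    (hG : SmoothNear (fun p : ℝ × Vec ρ => G p.1 p.2) (t₀, c₀)) :
    ∃ ψ : ℝ → Vec ρ → Vec ρ, IsGeneralSolution G ψ t₀ c₀ c₀ := by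
  -- Time is adjoined as a coordinate of speed `1`, which makes the system autonomous.
  obtain ⟨Φ, hs, h0, hd⟩ := exists_smooth_flow
    (w := fun p : ℝ × Vec ρ => ((1 : ℝ), G p.1 p.2)) ((smoothNear_const _).prodMk hG)
  have htime : ∀ᶠ p in 𝓝 ((0 : ℝ), (t₀, c₀)), (Φ p).1 = p.2.1 + p.1 := by
    have h1 := eventually_eq_of_hasDerivAt_zero (g := fun s z => (Φ (s, z)).1 - s)
      (t₀ := 0) (z₀ := (t₀, c₀)) (by
        filter_upwards [hd] with p hp
        have h := (hasFDerivAt_fst.comp_hasDerivAt p.1 hp).sub (hasDerivAt_id p.1)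
        rw [ContinuousLinearMap.coe_fst', sub_self] at h
        exact h)
    have h2 : Tendsto (fun p : ℝ × ℝ × Vec ρ => p.2) (𝓝 (0, (t₀, c₀))) (𝓝 (t₀, c₀)) :=
      Continuous.tendsto' (by fun_prop) _ _ rfl
    filter_upwards [h1, h2.eventually h0] with p h3 h4
    simp only [h4, sub_zero] at h3
    linarith
  have hj : Tendsto (fun p : ℝ × Vec ρ => (p.1 - t₀, (t₀, p.2))) (𝓝 (t₀, c₀))
      (𝓝 (0, (t₀, c₀))) := Continuous.tendsto' (by fun_prop) _ _ (by simp)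
  have hc : Tendsto (fun c : Vec ρ => (t₀, c)) (𝓝 c₀) (𝓝 (t₀, c₀)) :=
    Continuous.tendsto' (by fun_prop) _ _ rfl
  have hinit : ∀ᶠ c in 𝓝 c₀, (Φ (t₀ - t₀, (t₀, c))).2 = c := by
    filter_upwards [hc.eventually h0] with c h
    rw [sub_self, h]
  refine ⟨fun t c => (Φ (t - t₀, (t₀, c))).2, hinit.self_of_nhds, ?_, ?_, ?_⟩
  · have h1 : SmoothNear (fun p : ℝ × Vec ρ => Φ (p.1 - t₀, (t₀, p.2))) (t₀, c₀) :=
      SmoothNear.comp (g := Φ) (f := fun p : ℝ × Vec ρ => (p.1 - t₀, (t₀, p.2)))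
        (by simpa using hs) (smoothNear_of_contDiff (by fun_prop))
    exact h1.clm_comp_left (ContinuousLinearMap.snd ℝ _ _)
  · filter_upwards [hj.eventually hd, hj.eventually htime] with p h1 h2
    have h3 : HasDerivAt (fun s => Φ (s - t₀, (t₀, p.2))) _ p.1 := h1.comp_sub_const p.1 t₀
    have h4 := hasFDerivAt_snd.comp_hasDerivAt p.1 h3
    have h5 : t₀ + (p.1 - t₀) = p.1 := by ring
    simp only [h2, h5] at h4
    exact h4
  · have h1 : fderiv ℝ (fun c => (Φ (t₀ - t₀, (t₀, c))).2) c₀ = ContinuousLinearMap.id ℝ _ :=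
      (EventuallyEq.fderiv_eq (f := fun c => c) hinit).trans fderiv_fun_id
    rw [h1]
    have h2 : (Matrix.of fun a b : Fin ρ =>
        (ContinuousLinearMap.id ℝ (Vec ρ)) (Pi.single b 1) a) = 1 := by
      ext a b
      simp [Matrix.one_apply, Pi.single_apply]
    rw [h2, Matrix.det_one]
    exact one_ne_zero

end LocalFlow

/-! ### Rank, independent rows and the Gram matrix -/

section Rank

open Matrix

theorem linearIndependent_row_iff_rank {k n : ℕ} (M : Matrix (Fin k) (Fin n) ℝ) :
    LinearIndependent ℝ M.row ↔ M.rank = k := by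
  rw [linearIndependent_iff_card_eq_finrank_span, rank_eq_finrank_span_row, Fintype.card_fin,
    Set.finrank, eq_comm]

theorem det_ne_zero_iff_rank {k : ℕ} (M : Matrix (Fin k) (Fin k) ℝ) :
    M.det ≠ 0 ↔ M.rank = k := by
  rw [← linearIndependent_row_iff_rank, linearIndependent_rows_iff_isUnit,
    isUnit_iff_isUnit_det, isUnit_iff_ne_zero]

theorem det_mul_transpose_ne_zero {k n : ℕ} {M : Matrix (Fin k) (Fin n) ℝ} (h : M.rank = k) :
    (M * Mᵀ).det ≠ 0 := by
  rw [det_ne_zero_iff_rank, rank_self_mul_transpose, h]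

/-- For independent rows the Gram matrix `M * Mᵀ` is invertible, so the coefficients of a
combination of rows are given by a formula that is smooth in the data. -/
theorem vecMul_vecMul_gram {k n : ℕ} {M : Matrix (Fin k) (Fin n) ℝ} (h : M.rank = k)
    (y : Fin k → ℝ) : ((y ᵥ* M) ᵥ* Mᵀ) ᵥ* (M * Mᵀ)⁻¹ = y := by
  rw [vecMul_vecMul, vecMul_vecMul, ← Matrix.mul_assoc,
    mul_nonsing_inv _ (isUnit_iff_ne_zero.2 (det_mul_transpose_ne_zero h)), vecMul_one]

theorem exists_vecMul_eq_last {k n : ℕ} {M : Matrix (Fin k) (Fin n) ℝ}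
    {M' : Matrix (Fin (k + 1)) (Fin n) ℝ} (hM : ∀ i b, M' (Fin.castSucc i) b = M i b)
    (h : M.rank = k) (h' : M'.rank ≤ k) : ∃ y : Fin k → ℝ, y ᵥ* M = M' (Fin.last k) := by
  have h1 : ¬ LinearIndependent ℝ M'.row := by
    rw [linearIndependent_row_iff_rank]; omega
  have h2 : M'.row = Fin.snoc M.row (M' (Fin.last k)) := by
    funext i
    refine Fin.lastCases ?_ (fun j => ?_) i
    · exact (Fin.snoc_last (α := fun _ => Fin n → ℝ) _ _).symm
    · refine Eq.trans ?_ (Fin.snoc_castSucc (α := fun _ => Fin n → ℝ) _ _ _).symm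
      exact funext (hM j)
  rw [h2, linearIndependent_finSnoc, not_and_not_right] at h1
  have h3 := h1 ((linearIndependent_row_iff_rank M).2 h)
  obtain ⟨y, hy⟩ := (Submodule.mem_span_range_iff_exists_fun ℝ).1 h3
  refine ⟨y, ?_⟩
  rw [← hy]
  ext b
  simp [vecMul, dotProduct, Matrix.row, Finset.sum_apply]

end Rank

/-! ### Combinations with smooth coefficients -/

section SmoothSpan

variable {V W : Type*} [NormedAddCommGroup V] [NormedSpace ℝ V]
  [NormedAddCommGroup W] [NormedSpace ℝ W] {ι : Type*} [Fintype ι]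
  {m : ι → V → W} {p : V} {w w' : V → W}

/-- Near `p`, the function `w` is a combination of the functions `m i` with smooth coefficients. -/
def InSmoothSpan (m : ι → V → W) (p : V) (w : V → W) : Prop :=
  ∃ a : ι → V → ℝ, (∀ i, SmoothNear (a i) p) ∧ w =ᶠ[𝓝 p] fun q => ∑ i, a i q • m i q

theorem InSmoothSpan.congr (h : InSmoothSpan m p w) (e : w' =ᶠ[𝓝 p] w) : InSmoothSpan m p w' := by
  obtain ⟨a, ha, h⟩ := h
  exact ⟨a, ha, e.trans h⟩

theorem inSmoothSpan_self (i : ι) : InSmoothSpan m p (m i) := by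
  classical
  refine ⟨fun j _ => if j = i then 1 else 0, fun j => smoothNear_const _,
    Eventually.of_forall fun q => ?_⟩
  simp

theorem InSmoothSpan.smul {b : V → ℝ} (hb : SmoothNear b p) (h : InSmoothSpan m p w) :
    InSmoothSpan m p fun q => b q • w q := by
  obtain ⟨a, ha, h⟩ := h
  refine ⟨fun i q => b q * a i q, fun i => hb.mul (ha i), ?_⟩
  filter_upwards [h] with q hq
  simp only [hq, Finset.smul_sum, mul_smul]

theorem InSmoothSpan.add (h : InSmoothSpan m p w) (h' : InSmoothSpan m p w') :
    InSmoothSpan m p fun q => w q + w' q := by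
  obtain ⟨a, ha, h⟩ := h
  obtain ⟨a', ha', h'⟩ := h'
  refine ⟨fun i q => a i q + a' i q, fun i => (ha i).add (ha' i), ?_⟩
  filter_upwards [h, h'] with q hq hq'
  simp only [hq, hq', add_smul, Finset.sum_add_distrib]

theorem inSmoothSpan_zero : InSmoothSpan m p fun _ => 0 :=
  ⟨fun _ _ => 0, fun _ => smoothNear_const _, Eventually.of_forall fun q => by simp⟩

theorem InSmoothSpan.sum {κ : Type*} (s : Finset κ) {u : κ → V → W}
    (h : ∀ j ∈ s, InSmoothSpan m p (u j)) : InSmoothSpan m p fun q => ∑ j ∈ s, u j q := by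
  classical
  induction s using Finset.induction_on with
  | empty => simpa using inSmoothSpan_zero
  | insert j s hj ih =>
    simp only [Finset.sum_insert hj]
    exact (h j (Finset.mem_insert_self j s)).add
      (ih fun i hi => h i (Finset.mem_insert_of_mem hi))

theorem InSmoothSpan.dirD {v : V} (hm : ∀ i, SmoothNear (m i) p)
    (hD : ∀ i, InSmoothSpan m p (dirD v (m i))) (h : InSmoothSpan m p w) :
    InSmoothSpan m p (dirD v w) := by
  obtain ⟨a, ha, h⟩ := h
  have h1 : InSmoothSpan m p
      fun q => ∑ i, (a i q • EvolAnsatz.dirD v (m i) q + EvolAnsatz.dirD v (a i) q • m i q) :=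
    InSmoothSpan.sum _ fun i _ =>
      ((hD i).smul (ha i)).add ((inSmoothSpan_self i).smul ((ha i).dirD v))
  refine h1.congr ((dirD_congr v h).trans ?_)
  filter_upwards [eventually_all.2 fun i => (hm i).eventually,
    eventually_all.2 fun i => (ha i).eventually] with q h2 h3
  have h4 : HasFDerivAt (fun q => ∑ i, a i q • m i q) _ q :=
    HasFDerivAt.fun_sum fun i _ =>
      (h3 i).differentiableAt.hasFDerivAt.smul (h2 i).differentiableAt.hasFDerivAt
  simp only [EvolAnsatz.dirD, h4.fderiv]
  simp

theorem InSmoothSpan.iterate_dirD {v : V} (hm : ∀ i, SmoothNear (m i) p)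
    (hD : ∀ i, InSmoothSpan m p (EvolAnsatz.dirD v (m i))) (h : InSmoothSpan m p w) (k : ℕ) :
    InSmoothSpan m p ((EvolAnsatz.dirD v)^[k] w) := by
  induction k with
  | zero => exact h
  | succ k ih =>
    rw [Function.iterate_succ_apply']
    exact ih.dirD hm hD

/-- If the `v`-derivatives of the functions `m i` are smooth combinations of these functions, then
linear functionals applied to the `m i` satisfy a linear differential inequality. -/
theorem exists_bound_dirD {v : V} (h : ∀ i, InSmoothSpan m p (dirD v (m i))) :
    ∃ C : ℝ, 0 ≤ C ∧ ∀ᶠ q in 𝓝 p, ∀ L : W →L[ℝ] ℝ,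
      ‖fun i => L (dirD v (m i) q)‖ ≤ C * ‖fun i => L (m i q)‖ := by
  choose a ha h using h
  -- Near `p` each coefficient is bounded by its absolute value at `p` plus `1`; the bound and the
  -- neighbourhood serve all functionals `L`.
  refine ⟨∑ i, ∑ j, (|a i j p| + 1), by positivity, ?_⟩
  have hb : ∀ᶠ q in 𝓝 p, ∀ i j, |a i j q| < |a i j p| + 1 :=
    eventually_all.2 fun i => eventually_all.2 fun j =>
      (ha i j).continuousAt.abs.eventually_lt_const (lt_add_one _)
  filter_upwards [eventually_all.2 h, hb] with q hq hbq L
  have hC : 0 ≤ ∑ i, ∑ j, (|a i j p| + 1) := by positivity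
  refine (pi_norm_le_iff_of_nonneg (by positivity)).2 fun i => ?_
  rw [hq i, map_sum]
  calc ‖∑ j, L (a i j q • m j q)‖ ≤ ∑ j, ‖L (a i j q • m j q)‖ := norm_sum_le _ _
    _ ≤ ∑ j, (|a i j p| + 1) * ‖fun i => L (m i q)‖ := by
        refine Finset.sum_le_sum fun j _ => ?_
        rw [map_smul, norm_smul, Real.norm_eq_abs]
        exact mul_le_mul (hbq i j).le (norm_le_pi_norm (fun i => L (m i q)) j)
          (norm_nonneg _) (by positivity)
    _ = (∑ j, (|a i j p| + 1)) * ‖fun i => L (m i q)‖ := by rw [Finset.sum_mul]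
    _ ≤ _ := by
        refine mul_le_mul_of_nonneg_right ?_ (norm_nonneg _)
        exact Finset.single_le_sum (f := fun i => ∑ j, (|a i j p| + 1))
          (fun i _ => by positivity) (Finset.mem_univ i)

end SmoothSpan

/-! ### Grönwall: annihilated directions are the same for all `t` and `x` -/

section Kernel

variable {ρ : ℕ} {W : Type*} [NormedAddCommGroup W] [NormedSpace ℝ W] {ι : Type*} [Fintype ι]
  {m : ι → ℝ × ℝ × Vec ρ → W} {p : ℝ × ℝ × Vec ρ}

/-- Common zeros of functions that form a linear system closed under differentiation with respect
to `t` and `x` do not depend on `t` and `x`. -/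
theorem eventually_zero_of_inSmoothSpan (hm : ∀ i, SmoothNear (m i) p)
    (hT : ∀ i, InSmoothSpan m p (dirD eT (m i))) (hX : ∀ i, InSmoothSpan m p (dirD eX (m i))) :
    ∀ᶠ q in 𝓝 p, ∀ L : W →L[ℝ] ℝ,
      (∀ i, L (m i (p.1, p.2.1, q.2.2)) = 0) → ∀ i, L (m i q) = 0 := by
  obtain ⟨A, hA0, hA⟩ := exists_bound_dirD hT
  obtain ⟨B, hB0, hB⟩ := exists_bound_dirD hX
  have hsm : ∀ᶠ q in 𝓝 p, ∀ i, SmoothNear (m i) q :=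
    eventually_all.2 fun i => (hm i).eventually
  obtain ⟨ε, hε, H⟩ := Metric.eventually_nhds_iff_ball.1 (hsm.and (hA.and hB))
  filter_upwards [Metric.ball_mem_nhds _ hε] with q hq L h0
  set τ := q.1 - p.1 with hτ
  set ξ := q.2.1 - p.2.1 with hξ
  -- A segment to `q` with the parameters frozen. Along it the vector of values `L (m i)` starts at
  -- `0` and its derivative is bounded by a constant times its norm, so it stays `0`.
  set path : ℝ → ℝ × ℝ × Vec ρ := fun s => (p.1 + s * τ, p.2.1 + s * ξ, q.2.2) with hpath
  have hmem : ∀ s ∈ Set.Icc (0 : ℝ) 1, path s ∈ Metric.ball p ε := by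
    intro s hs
    rw [← ball_prod_same, ← ball_prod_same] at hq ⊢
    obtain ⟨h1, h2, h3⟩ := hq
    have h4 : ∀ r : ℝ, |s * r| ≤ |r| := fun r => by
      rw [abs_mul, abs_of_nonneg hs.1]
      exact mul_le_of_le_one_left (abs_nonneg _) hs.2
    rw [Metric.mem_ball, Real.dist_eq] at h1 h2
    refine ⟨?_, ?_, h3⟩
    · rw [Metric.mem_ball, Real.dist_eq, add_sub_cancel_left]
      exact (h4 _).trans_lt h1
    · rw [Metric.mem_ball, Real.dist_eq, add_sub_cancel_left]
      exact (h4 _).trans_lt h2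
  have hpd : ∀ s, HasDerivAt path (τ • eT + ξ • eX) s := by
    intro s
    have h1 : HasDerivAt (fun s : ℝ => p.1 + s * τ) τ s := by
      simpa using ((hasDerivAt_id s).mul_const τ).const_add p.1
    have h2 : HasDerivAt (fun s : ℝ => p.2.1 + s * ξ) ξ s := by
      simpa using ((hasDerivAt_id s).mul_const ξ).const_add p.2.1
    refine (h1.prodMk (h2.prodMk (hasDerivAt_const s q.2.2))).congr_deriv ?_
    simp [eT, eX]
  have hd : ∀ s ∈ Set.Icc (0 : ℝ) 1, HasDerivAt (fun s => fun i => L (m i (path s)))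
      (fun i => τ * L (dirD eT (m i) (path s)) + ξ * L (dirD eX (m i) (path s))) s := by
    intro s hs
    refine hasDerivAt_pi.2 fun i => ?_
    have h1 := ((H _ (hmem s hs)).1 i).differentiableAt.hasFDerivAt.comp_hasDerivAt s (hpd s)
    have h2 := L.hasFDerivAt.comp_hasDerivAt s h1
    refine h2.congr_deriv ?_
    simp [dirD]
  have key := eq_zero_of_abs_deriv_le_mul_abs_self_of_eq_zero_right
    (f := fun s => fun i => L (m i (path s))) (K := |τ| * A + |ξ| * B)
    (fun s hs => (hd s hs).continuousAt.continuousWithinAt)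
    (fun s hs => (hd s (Set.Ico_subset_Icc_self hs)).hasDerivWithinAt)
    (by ext i; simpa [hpath] using h0 i)
    (fun s hs => by
      have h1 := (H _ (hmem s (Set.Ico_subset_Icc_self hs))).2
      have h2 : (fun i => τ * L (dirD eT (m i) (path s)) + ξ * L (dirD eX (m i) (path s))) =
          τ • (fun i => L (dirD eT (m i) (path s))) + ξ • fun i => L (dirD eX (m i) (path s)) :=
        rfl
      rw [h2, add_mul, mul_assoc, mul_assoc]
      refine (norm_add_le _ _).trans (add_le_add ?_ ?_)
      · rw [norm_smul, Real.norm_eq_abs]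
        exact mul_le_mul_of_nonneg_left (h1.1 L) (abs_nonneg _)
      · rw [norm_smul, Real.norm_eq_abs]
        exact mul_le_mul_of_nonneg_left (h1.2 L) (abs_nonneg _))
    1 (by simp)
  intro i
  have h1 : path 1 = q := by simp [hpath, hτ, hξ]
  have := congrFun key i
  simpa [h1] using this

end Kernel

/-! ### Factorization through a submersion -/

section Straightening

variable {ρ k : ℕ} {f : ℝ → ℝ → Vec ρ → ℝ} {t₀ x₀ : ℝ} {κ₀ : Vec ρ}

/-- A function of `(t, x, κ)` whose derivative vanishes along the level sets of a submersion
`ζ(κ)` is a function of `(t, x, ζ)`. -/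
theorem exists_factorization {ζ : Vec ρ → Vec k} (hζ : SmoothNear ζ κ₀)
    (hsurj : (fderiv ℝ ζ κ₀ : Vec ρ →ₗ[ℝ] Vec k).range = ⊤)
    (hf : SmoothNear (unc f) (t₀, x₀, κ₀))
    (hker : ∀ᶠ q in 𝓝 (t₀, x₀, κ₀), ∀ v, fderiv ℝ ζ q.2.2 v = 0 → gradC (unc f) q v = 0) :
    ∃ g : ℝ → ℝ → Vec k → ℝ, SmoothNear (unc g) (t₀, x₀, ζ κ₀) ∧
      ∀ᶠ q in 𝓝 (t₀, x₀, κ₀), f q.1 q.2.1 q.2.2 = g q.1 q.2.1 (ζ q.2.2) := by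
  set D := fderiv ℝ ζ κ₀ with hD
  obtain ⟨R', hR'⟩ := (D : Vec ρ →ₗ[ℝ] Vec k).exists_rightInverse_of_surjective hsurj
  let R : Vec k →L[ℝ] Vec ρ := LinearMap.toContinuousLinearMap R'
  have hDR : ∀ z, D (R z) = z := fun z => LinearMap.congr_fun hR' z
  set Ψ : Vec ρ → Vec ρ := fun c => c + R (ζ c - D c) with hΨ
  have hDΨ : ∀ c, D (Ψ c) = ζ c := fun c => by simp [hΨ, hDR]
  have hΨs : SmoothNear Ψ κ₀ :=
    (smoothNear_of_contDiff contDiff_id).add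
      ((hζ.sub (smoothNear_of_contDiff D.contDiff)).clm_comp_left R)
  have hΨd : HasFDerivAt Ψ ((ContinuousLinearEquiv.refl ℝ (Vec ρ) : Vec ρ →L[ℝ] Vec ρ)) κ₀ := by
    have h1 := (hasFDerivAt_id (𝕜 := ℝ) κ₀).add
      (R.hasFDerivAt.comp κ₀ (hζ.differentiableAt.hasFDerivAt.sub D.hasFDerivAt))
    refine h1.congr_fderiv ?_
    ext v
    simp [hD]
  obtain ⟨Θ, hΘ, hΘ0, hΘ1, hΘ2⟩ := hΨs.exists_localInverse hΨd
  set y₀ := Ψ κ₀ with hy₀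
  set z₀ := ζ κ₀ with hz₀
  have hΘt : Tendsto Θ (𝓝 y₀) (𝓝 κ₀) := by simpa [ContinuousAt, hΘ0] using hΘ.continuousAt
  set h : ℝ → ℝ → Vec ρ → ℝ := fun t x y => f t x (Θ y) with hh
  have hpt : Tendsto (fun q : ℝ × ℝ × Vec ρ => (q.1, q.2.1, Θ q.2.2)) (𝓝 (t₀, x₀, y₀))
      (𝓝 (t₀, x₀, κ₀)) :=
    (Continuous.tendsto' (by fun_prop) _ _ rfl).prodMk_nhds
      ((Continuous.tendsto' (by fun_prop) _ _ rfl).prodMk_nhds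
        (hΘt.comp (Continuous.tendsto' (by fun_prop) _ _ rfl)))
  have h3 : Tendsto (fun q : ℝ × ℝ × Vec ρ => q.2.2) (𝓝 (t₀, x₀, y₀)) (𝓝 y₀) :=
    Continuous.tendsto' (by fun_prop) _ _ rfl
  have hsm : SmoothNear (unc h) (t₀, x₀, y₀) := by
    refine SmoothNear.comp (g := unc f) (f := fun q : ℝ × ℝ × Vec ρ => (q.1, q.2.1, Θ q.2.2))
      (by rw [hΘ0]; exact hf) ?_
    refine (smoothNear_of_contDiff contDiff_fst).prodMk
      ((smoothNear_of_contDiff contDiff_snd.fst).prodMk ?_)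
    exact SmoothNear.comp (g := Θ) (f := fun q : ℝ × ℝ × Vec ρ => q.2.2) hΘ
      (smoothNear_of_contDiff contDiff_snd.snd)
  have hflat : ∀ᶠ q in 𝓝 (t₀, x₀, y₀), ∀ v, D v = 0 →
      HasFDerivAt (fun y => h q.1 q.2.1 y) (gradC (unc h) q) q.2.2 ∧ gradC (unc h) q v = 0 := by
    have e1 : ∀ᶠ y in 𝓝 y₀, ∀ᶠ y' in 𝓝 y, ζ (Θ y') = D y' := by
      refine eventually_eventually_nhds.2 ?_
      filter_upwards [hΘ2] with y hy
      rw [← hDΨ, hy]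
    filter_upwards [hsm.eventually, hpt.eventually hker, hpt.eventually hf.eventually,
      h3.eventually e1, h3.eventually hΘ.eventually, h3.eventually (hΘt.eventually hζ.eventually)]
      with q a1 a2 a3 a4 a5 a6 v hv
    have b1 : HasFDerivAt (fun y => h q.1 q.2.1 y) (gradC (unc h) q) q.2.2 :=
      fderiv_slice_c a1.differentiableAt
    refine ⟨b1, ?_⟩
    have b2 : HasFDerivAt (fun c => f q.1 q.2.1 c) (gradC (unc f) (q.1, q.2.1, Θ q.2.2)) (Θ q.2.2) :=
      fderiv_slice_c a3.differentiableAt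
    have b3 := a5.differentiableAt.hasFDerivAt
    have b4 : gradC (unc h) q = _ := b1.unique (b2.comp q.2.2 b3)
    rw [b4, ContinuousLinearMap.comp_apply]
    refine a2 _ ?_
    have b5 := a6.differentiableAt.hasFDerivAt.comp q.2.2 b3
    have b6 := b5.unique (D.hasFDerivAt.congr_of_eventuallyEq a4)
    simpa [hv] using congrArg (· v) b6
  obtain ⟨ε, hε, H⟩ := Metric.eventually_nhds_iff_ball.1 hflat
  -- Fibres of `D` meet the ball in convex sets, so `h` is constant on each of them.
  have hconst : ∀ t x y y', (t, x, y) ∈ Metric.ball (t₀, x₀, y₀) ε →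
      (t, x, y') ∈ Metric.ball (t₀, x₀, y₀) ε → D y = D y' → h t x y = h t x y' := by
    intro t x y y' hy hy' hyy
    have hseg : ∀ s ∈ Set.Icc (0 : ℝ) 1, (t, x, y' + s • (y - y')) ∈ Metric.ball (t₀, x₀, y₀) ε := by
      intro s hs
      have := (convex_ball (t₀, x₀, y₀) ε).add_smul_sub_mem hy' hy hs
      simpa using this
    have hv : D (y - y') = 0 := by rw [map_sub, hyy, sub_self]
    have hd : ∀ s ∈ Set.Icc (0 : ℝ) 1, HasDerivAt (fun s : ℝ => h t x (y' + s • (y - y'))) 0 s := by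
      intro s hs
      obtain ⟨c1, c2⟩ := H _ (hseg s hs) _ hv
      have c3 : HasDerivAt (fun s : ℝ => y' + s • (y - y')) (y - y') s := by
        simpa using ((hasDerivAt_id s).smul_const (y - y')).const_add y'
      exact (c1.comp_hasDerivAt s c3).congr_deriv c2
    have := constant_of_has_deriv_right_zero (f := fun s : ℝ => h t x (y' + s • (y - y')))
      (fun s hs => (hd s hs).continuousAt.continuousWithinAt)
      (fun s hs => (hd s (Set.Ico_subset_Icc_self hs)).hasDerivWithinAt) 1 (by simp)
    simpa using this
  -- The affine section `z ↦ y₀ + R (z - z₀)` chooses one point on each fibre of `D`; for `z = ζ κ`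
  -- it lies on the fibre of `Ψ κ`.
  refine ⟨fun t x z => h t x (y₀ + R (z - z₀)), ?_, ?_⟩
  · refine SmoothNear.comp (g := unc h)
      (f := fun q : ℝ × ℝ × Vec k => (q.1, q.2.1, y₀ + R (q.2.2 - z₀))) (by simpa using hsm)
      (smoothNear_of_contDiff (by fun_prop))
  · have hΨc : Tendsto Ψ (𝓝 κ₀) (𝓝 y₀) := hΨs.continuousAt
    have hζc : Tendsto ζ (𝓝 κ₀) (𝓝 z₀) := hζ.continuousAt
    have d0 : Tendsto (fun q : ℝ × ℝ × Vec ρ => q.2.2) (𝓝 (t₀, x₀, κ₀)) (𝓝 κ₀) :=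
      Continuous.tendsto' (by fun_prop) _ _ rfl
    have d1 : Tendsto (fun q : ℝ × ℝ × Vec ρ => (q.1, q.2.1, Ψ q.2.2)) (𝓝 (t₀, x₀, κ₀))
        (𝓝 (t₀, x₀, y₀)) :=
      (Continuous.tendsto' (by fun_prop) _ _ rfl).prodMk_nhds
        ((Continuous.tendsto' (by fun_prop) _ _ rfl).prodMk_nhds (hΨc.comp d0))
    have d2 : Tendsto (fun q : ℝ × ℝ × Vec ρ => (q.1, q.2.1, y₀ + R (ζ q.2.2 - z₀)))
        (𝓝 (t₀, x₀, κ₀)) (𝓝 (t₀, x₀, y₀)) := by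
      refine (Continuous.tendsto' (by fun_prop) _ _ rfl).prodMk_nhds
        ((Continuous.tendsto' (by fun_prop) _ _ rfl).prodMk_nhds ?_)
      have : Tendsto (fun z => y₀ + R (z - z₀)) (𝓝 z₀) (𝓝 y₀) :=
        Continuous.tendsto' (by fun_prop) _ _ (by simp)
      exact this.comp (hζc.comp d0)
    filter_upwards [d1.eventually (Metric.ball_mem_nhds _ hε),
      d2.eventually (Metric.ball_mem_nhds _ hε), d0.eventually hΘ1] with q e1 e2 e3
    have e4 := hconst _ _ _ _ e1 e2 (by
      rw [hDΨ, map_add, hDR, hy₀, hDΨ]; abel)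
    rw [← e4]
    simp only [hh]
    rw [e3]

end Straightening

/-! ### Invertibility of the Jacobian for a family of solutions -/

section Families

variable {ρ k : ℕ} {f : ℝ → ℝ → Vec ρ → ℝ} {p : ℝ × ℝ × Vec ρ}

/-- The gradient of `f_i` with respect to the parameters. -/
def gradDx (f : ℝ → ℝ → Vec ρ → ℝ) (i : ℕ) : ℝ × ℝ × Vec ρ → (Vec ρ →L[ℝ] ℝ) :=
  gradC ((dirD eX)^[i] (unc f))

theorem SmoothNear.gradDx (hf : SmoothNear (unc f) p) (i : ℕ) : SmoothNear (gradDx f i) p :=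
  (hf.iterate_dirD eX i).gradC

theorem dirD_eX_gradDx (hf : SmoothNear (unc f) p) (i : ℕ) :
    dirD eX (gradDx f i) =ᶠ[𝓝 p] gradDx f (i + 1) := by
  rw [gradDx, gradDx, Function.iterate_succ_apply']
  exact dirD_gradC eX (hf.iterate_dirD eX i)

theorem iterate_dirD_eX_gradC {g : ℝ × ℝ × Vec ρ → ℝ} (hg : SmoothNear g p) (i : ℕ) :
    (dirD eX)^[i] (gradC g) =ᶠ[𝓝 p] gradC ((dirD eX)^[i] g) := by
  induction i with
  | zero => exact EventuallyEq.rfl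
  | succ i ih =>
    simp only [Function.iterate_succ_apply']
    exact (dirD_congr eX ih).trans (dirD_gradC eX (hg.iterate_dirD eX i))

theorem clm_ext_single {u v : Vec ρ →L[ℝ] ℝ} (h : ∀ b, u (Pi.single b 1) = v (Pi.single b 1)) :
    u = v := by
  refine ContinuousLinearMap.coe_injective (LinearMap.pi_ext' fun b => LinearMap.ext_ring ?_)
  exact h b

/-- The first `k` rows stay independent and the next depends on them at each nearby point; the Gram
formula makes the pointwise coefficients smooth. -/
theorem inSmoothSpan_gradDx_of_rank (hf : SmoothNear (unc f) p)
    (hk : ∀ᶠ q in 𝓝 p, (xJacobian k f q.1 q.2.1 q.2.2).rank = k)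
    (hk' : ∀ᶠ q in 𝓝 p, (xJacobian (k + 1) f q.1 q.2.1 q.2.2).rank ≤ k) :
    InSmoothSpan (fun i : Fin k => gradDx f i) p (gradDx f k) := by
  set M : ℝ × ℝ × Vec ρ → Matrix (Fin k) (Fin ρ) ℝ := fun q => xJacobian k f q.1 q.2.1 q.2.2
    with hM
  set M' : ℝ × ℝ × Vec ρ → Matrix (Fin (k + 1)) (Fin ρ) ℝ :=
    fun q => xJacobian (k + 1) f q.1 q.2.1 q.2.2 with hM'
  have hMs : ∀ i b, SmoothNear (fun q => M q i b) p := fun i b => hf.xJacobian k i b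
  have hMs' : ∀ i b, SmoothNear (fun q => M' q i b) p := fun i b => hf.xJacobian (k + 1) i b
  refine ⟨fun j q => Matrix.vecMul (Matrix.vecMul (M' q (Fin.last k)) (M q).transpose)
    (M q * (M q).transpose)⁻¹ j, fun j => ?_, ?_⟩
  · simp only [Matrix.vecMul, dotProduct]
    refine SmoothNear.sum fun i _ => SmoothNear.mul (SmoothNear.sum fun b _ => ?_) ?_
    · exact (hMs' _ _).mul (hMs _ _)
    · refine smoothNear_inv (A := fun q => M q * (M q).transpose) (fun a b => ?_)
        (det_mul_transpose_ne_zero hk.self_of_nhds) i j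
      simp only [Matrix.mul_apply]
      exact SmoothNear.sum fun c _ => (hMs _ _).mul (hMs _ _)
  · filter_upwards [hk, hk', xJacobian_apply_eventually k hf,
      xJacobian_apply_eventually (k + 1) hf] with q h1 h2 h3 h4
    obtain ⟨y, hy⟩ := exists_vecMul_eq_last (M := M q) (M' := M' q) (fun _ _ => rfl) h1 h2
    simp only [← hy, vecMul_vecMul_gram (M := M q) h1]
    refine clm_ext_single fun b => ?_
    have h5 : M' q (Fin.last k) b = gradDx f k q (Pi.single b 1) :=
      h4 (Fin.last k) b
    rw [← h5, ← hy]
    simp only [Matrix.vecMul, dotProduct, sum_apply,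
      smul_apply, smul_eq_mul]
    exact Finset.sum_congr rfl fun i _ => by rw [hM]; simp only [h3]; rfl

/-- `∂_x` shifts the index by one; only the last gradient leaves the list, and it becomes `gradDx f
k`. -/
theorem inSmoothSpan_dirD_eX_gradDx (hf : SmoothNear (unc f) p)
    (h : InSmoothSpan (fun i : Fin k => gradDx f i) p (gradDx f k)) (i : Fin k) :
    InSmoothSpan (fun i : Fin k => gradDx f i) p (dirD eX (gradDx f i)) := by
  refine InSmoothSpan.congr ?_ (dirD_eX_gradDx hf i)
  rcases (Nat.succ_le_of_lt i.2).lt_or_eq with hi | hi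
  · exact inSmoothSpan_self (m := fun i : Fin k => gradDx f i) (⟨i + 1, hi⟩ : Fin k)
  · have e : gradDx f (i + 1) = gradDx f k := congrArg _ hi
    rw [e]
    exact h

theorem inSmoothSpan_gradDx (hf : SmoothNear (unc f) p)
    (h : InSmoothSpan (fun i : Fin k => gradDx f i) p (gradDx f k)) (j : ℕ) :
    InSmoothSpan (fun i : Fin k => gradDx f i) p (gradDx f j) := by
  induction j with
  | zero =>
    rcases Nat.eq_zero_or_pos k with rfl | hk
    · exact h
    · exact inSmoothSpan_self (m := fun i : Fin k => gradDx f i) (⟨0, hk⟩ : Fin k)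
  | succ j ih =>
    exact (ih.dirD (fun i : Fin k => hf.gradDx i) (inSmoothSpan_dirD_eX_gradDx hf h)).congr
      (dirD_eX_gradDx hf j).symm

theorem gradC_comp_xJet {r : ℕ} {H : ℝ × ℝ × Vec (r + 1) → ℝ} (hf : SmoothNear (unc f) p)
    (hH : SmoothNear H (xJet r f p.1 p.2.1 p.2.2)) :
    gradC (fun q => H (xJet r f q.1 q.2.1 q.2.2)) =ᶠ[𝓝 p] fun q =>
      ∑ j : Fin (r + 1), fderiv ℝ H (xJet r f q.1 q.2.1 q.2.2) (0, 0, Pi.single j 1) •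
        gradDx f j q := by
  have hJ := hf.xJet r
  filter_upwards [hf.eventually, hJ.continuousAt.eventually hH.eventually,
    eventually_all.2 fun j : Fin (r + 1) => gradC_congr (unc_dx j hf)] with q h1 h2 h3
  ext v
  have a1 : HasFDerivAt (fun q : ℝ × ℝ × Vec ρ => fun j : Fin (r + 1) => unc (dx j f) q)
      (ContinuousLinearMap.pi fun j : Fin (r + 1) => fderiv ℝ (unc (dx j f)) q) q :=
    hasFDerivAt_pi.2 fun j => (h1.dx j).differentiableAt.hasFDerivAt
  have a2 := (hasFDerivAt_fst (𝕜 := ℝ) (p := q)).prodMk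
    ((hasFDerivAt_snd (𝕜 := ℝ) (p := q)).fst.prodMk a1)
  have a3 : HasFDerivAt (fun q => H (xJet r f q.1 q.2.1 q.2.2)) _ q :=
    HasFDerivAt.comp (g := H) q h2.differentiableAt.hasFDerivAt a2
  have a4 : gradC (fun q => H (xJet r f q.1 q.2.1 q.2.2)) q v =
      fderiv ℝ H (xJet r f q.1 q.2.1 q.2.2) (0, 0, fun j => gradC (unc (dx j f)) q v) := by
    rw [gradC, a3.fderiv]
    simp [gradC]
  have a5 : ((0, 0, fun j => gradC (unc (dx j f)) q v) : ℝ × ℝ × Vec (r + 1)) =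
      ∑ j : Fin (r + 1), gradC (unc (dx j f)) q v • (0, 0, Pi.single j 1) := by
    refine Prod.ext ?_ (Prod.ext ?_ ?_)
    · simp [Prod.fst_sum]
    · simp [Prod.fst_sum, Prod.snd_sum]
    · ext i
      simp [Prod.snd_sum, Finset.sum_apply, Pi.single_apply]
  rw [a4, a5, map_sum, sum_apply]
  refine Finset.sum_congr rfl fun j _ => ?_
  rw [map_smul, h3 j, smul_apply, smul_eq_mul, smul_eq_mul, mul_comm]
  rfl

theorem smoothNear_H (E : EvolEq) {z : ℝ × ℝ × Vec (E.r + 1)} (hz : z ∈ E.dom) :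
    SmoothNear E.H z :=
  smoothNear_of_isOpen E.isOpen_dom E.smooth_H hz

variable {E : EvolEq} {t₀ x₀ : ℝ} {κ₀ : Vec ρ}

theorem IsSolutionFamilyAt.dirD_eT (h : IsSolutionFamilyAt E f t₀ x₀ κ₀) :
    dirD eT (unc f) =ᶠ[𝓝 (t₀, x₀, κ₀)] fun q => E.H (xJet E.r f q.1 q.2.1 q.2.2) := by
  obtain ⟨hf, -, hsol⟩ := h
  filter_upwards [unc_dt hf, hsol] with q h1 h2
  rw [← h1, ← h2]
  rfl

/-- The only use of the equation in the rank argument: `∂_t ∇f_i = ∂_x^i ∇(H(t, x, f_0, …, f_r))`,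
the chain rule puts `∇H` in the span, and the span is closed under `∂_x`. -/
theorem IsSolutionFamilyAt.inSmoothSpan_dirD_eT (h : IsSolutionFamilyAt E f t₀ x₀ κ₀)
    (hs : InSmoothSpan (fun i : Fin k => gradDx f i) (t₀, x₀, κ₀) (gradDx f k)) (i : ℕ) :
    InSmoothSpan (fun i : Fin k => gradDx f i) (t₀, x₀, κ₀) (EvolAnsatz.dirD eT (gradDx f i)) := by
  have hf : SmoothNear (unc f) (t₀, x₀, κ₀) := h.1
  have hH := smoothNear_H E h.2.1
  have h1 : InSmoothSpan (fun i : Fin k => gradDx f i) (t₀, x₀, κ₀)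
      (gradC (EvolAnsatz.dirD eT (unc f))) := by
    refine InSmoothSpan.congr ?_ ((gradC_congr h.dirD_eT).trans (gradC_comp_xJet hf hH))
    refine InSmoothSpan.sum _ fun j _ => (inSmoothSpan_gradDx hf hs j).smul ?_
    exact SmoothNear.comp (g := EvolAnsatz.dirD (0, 0, Pi.single j 1) E.H) (hH.dirD _) (hf.xJet E.r)
  refine (h1.iterate_dirD (fun i : Fin k => hf.gradDx i)
    (inSmoothSpan_dirD_eX_gradDx hf hs) i).congr ?_
  refine (dirD_gradC eT (hf.iterate_dirD eX i)).trans ?_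
  exact (gradC_congr (dirD_iterate_comm eT eX i hf)).trans
    (iterate_dirD_eX_gradC (hf.dirD eT) i).symm

/-- Here `k + 1` is the least number of rows that are dependent at the base point; regularity
carries both ranks to nearby points. -/
theorem exists_rank_drop (hreg : RegularAt f t₀ x₀ κ₀)
    (hdet : (xJacobian ρ f t₀ x₀ κ₀).rank < ρ) : ∃ k < ρ,
      (∀ᶠ q in 𝓝 (t₀, x₀, κ₀), (xJacobian k f q.1 q.2.1 q.2.2).rank = k) ∧
      ∀ᶠ q in 𝓝 (t₀, x₀, κ₀), (xJacobian (k + 1) f q.1 q.2.1 q.2.2).rank ≤ k := by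
  classical
  have hex : ∃ n, (xJacobian n f t₀ x₀ κ₀).rank < n := ⟨ρ, hdet⟩
  obtain ⟨k, hk⟩ : ∃ k, Nat.find hex = k + 1 :=
    Nat.exists_eq_succ_of_ne_zero fun h0 => by
      have := Nat.find_spec hex
      rw [h0] at this
      exact Nat.not_lt_zero _ this
  have h1 : (xJacobian (k + 1) f t₀ x₀ κ₀).rank < k + 1 := hk ▸ Nat.find_spec hex
  have h2 : ¬ (xJacobian k f t₀ x₀ κ₀).rank < k := Nat.find_min hex (by omega)
  have h3 : k + 1 ≤ ρ := hk ▸ Nat.find_min' hex hdet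
  have h4 : (xJacobian k f t₀ x₀ κ₀).rank = k :=
    le_antisymm (Matrix.rank_le_height _) (not_lt.1 h2)
  refine ⟨k, h3, ?_, ?_⟩
  · filter_upwards [hreg k (by omega)] with q hq
    rw [hq, h4]
  · filter_upwards [hreg (k + 1) h3] with q hq
    rw [hq]
    omega

/-- At a regular point at which the parameters of a family of solutions are essential, the
Jacobian of `(f_0, …, f_{ρ-1})` with respect to the parameters does not vanish. -/
theorem IsSolutionFamilyAt.det_ne_zero (h : IsSolutionFamilyAt E f t₀ x₀ κ₀)
    (hess : EssentialParametersAt f t₀ x₀ κ₀) (hreg : RegularAt f t₀ x₀ κ₀) :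
    (xJacobian ρ f t₀ x₀ κ₀).det ≠ 0 := by
  rw [det_ne_zero_iff_rank]
  by_contra hne
  obtain ⟨k, hkρ, hk, hk'⟩ := exists_rank_drop hreg
    (lt_of_le_of_ne (Matrix.rank_le_height _) hne)
  have hf : SmoothNear (unc f) (t₀, x₀, κ₀) := h.1
  have hs := inSmoothSpan_gradDx_of_rank hf hk hk'
  have hX := inSmoothSpan_dirD_eX_gradDx hf hs
  have hT := fun i : Fin k => h.inSmoothSpan_dirD_eT hs i
  have hker := eventually_zero_of_inSmoothSpan (fun i : Fin k => hf.gradDx i) hT hX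
  obtain ⟨a, -, ha⟩ := inSmoothSpan_gradDx hf hs 0
  -- The `k < ρ` new parameters: `x`-derivatives at the fixed point `(t₀, x₀)`. Their differentials
  -- are the gradients at `(t₀, x₀, κ)`, from which `hker` transports zeros.
  set ζ : Vec ρ → Vec k := fun c i => dx i f t₀ x₀ c with hζ
  have hζs : SmoothNear ζ κ₀ := smoothNear_pi.2 fun i =>
    SmoothNear.comp (g := unc (dx i f)) (f := fun c : Vec ρ => (t₀, x₀, c)) (hf.dx i)
      (smoothNear_of_contDiff (by fun_prop))
  have hsl : Tendsto (fun c : Vec ρ => (t₀, x₀, c)) (𝓝 κ₀) (𝓝 (t₀, x₀, κ₀)) :=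
    tendsto_slice_c (t₀, x₀, κ₀)
  have hζd : ∀ᶠ c in 𝓝 κ₀, ∀ v i, fderiv ℝ ζ c v i = gradDx f i (t₀, x₀, c) v := by
    filter_upwards [hsl.eventually hf.eventually, hsl.eventually
      (eventually_all.2 fun i : Fin k => gradC_congr (unc_dx i hf))] with c h1 h2 v i
    have h3 : HasFDerivAt ζ
        (ContinuousLinearMap.pi fun i : Fin k => gradC (unc (dx i f)) (t₀, x₀, c)) c :=
      hasFDerivAt_pi.2 fun i => fderiv_slice_c (p := (t₀, x₀, c)) (h1.dx i).differentiableAt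
    rw [h3.fderiv, ContinuousLinearMap.pi_apply, h2 i]
    rfl
  have hsurj : (fderiv ℝ ζ κ₀ : Vec ρ →ₗ[ℝ] Vec k).range = ⊤ := by
    have h1 : (xJacobian k f t₀ x₀ κ₀).mulVecLin = (fderiv ℝ ζ κ₀ : Vec ρ →ₗ[ℝ] Vec k) := by
      refine LinearMap.pi_ext' fun b => LinearMap.ext_ring (funext fun i => ?_)
      simp only [LinearMap.comp_apply, LinearMap.single_apply, Matrix.mulVecLin_apply,
        Matrix.mulVec_single_one, Matrix.col_apply]
      exact ((xJacobian_apply_eventually k hf).self_of_nhds i b).trans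
        (hζd.self_of_nhds _ i).symm
    rw [← h1]
    refine Submodule.eq_top_of_finrank_eq ?_
    rw [Module.finrank_fin_fun]
    exact hk.self_of_nhds
  obtain ⟨g, hg, hfg⟩ := exists_factorization hζs hsurj hf (by
    have h3 : Tendsto (fun q : ℝ × ℝ × Vec ρ => q.2.2) (𝓝 (t₀, x₀, κ₀)) (𝓝 κ₀) :=
      Continuous.tendsto' (by fun_prop) _ _ rfl
    filter_upwards [hker, ha, h3.eventually hζd] with q h1 h2 h4 v hv
    -- The functional is evaluation at `v`: a direction killed by the differential of `ζ` is killed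
    -- by all `gradDx f i`, `i < k`, at `q`, hence by the gradient of `f`.
    have h5 := h1 (ContinuousLinearMap.apply ℝ ℝ v) fun i => by
      have := congrFun hv i
      rw [h4] at this
      exact this
    change gradDx f 0 q v = 0
    rw [h2, sum_apply]
    refine Finset.sum_eq_zero fun i _ => ?_
    rw [smul_apply, show gradDx f i q v = 0 from h5 i, smul_zero])
  exact hess ⟨k, hkρ, g, ζ, hζs, hg, hfg⟩

end Families

/-! ### Chain rules for `F(t, x, ζ(t, κ))` -/

section Substitution

variable {ρ n : ℕ} {f : ℝ → ℝ → Vec ρ → ℝ} {F : ℝ → ℝ → Vec n → ℝ} {ζ : ℝ → Vec ρ → Vec n}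
  {t₀ x₀ : ℝ} {κ₀ : Vec ρ}

theorem tendsto_substitution (hζ : SmoothNear (fun p : ℝ × Vec ρ => ζ p.1 p.2) (t₀, κ₀)) :
    Tendsto (fun q : ℝ × ℝ × Vec ρ => (q.1, q.2.1, ζ q.1 q.2.2)) (𝓝 (t₀, x₀, κ₀))
      (𝓝 (t₀, x₀, ζ t₀ κ₀)) := by
  refine (Continuous.tendsto' (by fun_prop) _ _ rfl).prodMk_nhds
    ((Continuous.tendsto' (by fun_prop) _ _ rfl).prodMk_nhds ?_)
  have h1 : Tendsto (fun q : ℝ × ℝ × Vec ρ => (q.1, q.2.2)) (𝓝 (t₀, x₀, κ₀)) (𝓝 (t₀, κ₀)) :=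
    Continuous.tendsto' (by fun_prop) _ _ rfl
  exact hζ.continuousAt.tendsto.comp h1

theorem tendsto_forget_x : Tendsto (fun q : ℝ × ℝ × Vec ρ => (q.1, q.2.2)) (𝓝 (t₀, x₀, κ₀))
    (𝓝 (t₀, κ₀)) :=
  Continuous.tendsto' (by fun_prop) _ _ rfl

theorem tendsto_insert_x (x₀ : ℝ) : Tendsto (fun p : ℝ × Vec ρ => (p.1, x₀, p.2)) (𝓝 (t₀, κ₀))
    (𝓝 (t₀, x₀, κ₀)) :=
  Continuous.tendsto' (by fun_prop) _ _ rfl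

theorem tendsto_insert_t (t₀ : ℝ) : Tendsto (fun κ : Vec ρ => (t₀, κ)) (𝓝 κ₀) (𝓝 (t₀, κ₀)) :=
  Continuous.tendsto' (by fun_prop) _ _ rfl

theorem SmoothNear.substitution (hF : SmoothNear (unc F) (t₀, x₀, ζ t₀ κ₀))
    (hζ : SmoothNear (fun p : ℝ × Vec ρ => ζ p.1 p.2) (t₀, κ₀)) :
    SmoothNear (unc fun t x κ => F t x (ζ t κ)) (t₀, x₀, κ₀) := by
  refine SmoothNear.comp (g := unc F)
    (f := fun q : ℝ × ℝ × Vec ρ => (q.1, q.2.1, ζ q.1 q.2.2)) hF ?_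
  refine (smoothNear_of_contDiff contDiff_fst).prodMk
    ((smoothNear_of_contDiff contDiff_snd.fst).prodMk ?_)
  exact SmoothNear.comp (g := fun p : ℝ × Vec ρ => ζ p.1 p.2)
    (f := fun q : ℝ × ℝ × Vec ρ => (q.1, q.2.2)) hζ (smoothNear_of_contDiff (by fun_prop))

theorem SmoothNear.slice_κ (hζ : SmoothNear (fun p : ℝ × Vec ρ => ζ p.1 p.2) (t₀, κ₀)) :
    SmoothNear (ζ t₀) κ₀ :=
  SmoothNear.comp (g := fun p : ℝ × Vec ρ => ζ p.1 p.2) (f := fun κ : Vec ρ => (t₀, κ)) hζ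
    (smoothNear_of_contDiff (by fun_prop))

theorem SmoothNear.differentiableAt_t
    (hζ : SmoothNear (fun p : ℝ × Vec ρ => ζ p.1 p.2) (t₀, κ₀)) :
    DifferentiableAt ℝ (fun s => ζ s κ₀) t₀ :=
  DifferentiableAt.comp (g := fun p : ℝ × Vec ρ => ζ p.1 p.2) (f := fun s : ℝ => (s, κ₀)) t₀
    hζ.differentiableAt (by fun_prop)

theorem xJacobian_mulVec {p : ℝ × ℝ × Vec ρ} (hf : SmoothNear (unc f) p) (k : ℕ) (v : Vec ρ)
    (i : Fin k) : Matrix.mulVec (xJacobian k f p.1 p.2.1 p.2.2) v i =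
      gradC (unc (dx i f)) p v := by
  have h1 : ∀ b, xJacobian k f p.1 p.2.1 p.2.2 i b = gradC (unc (dx i f)) p (Pi.single b 1) :=
    fun b => congrArg (· (Pi.single b 1)) (fderiv_slice_c (hf.dx i).differentiableAt).fderiv
  simp only [Matrix.mulVec, dotProduct, h1]
  rw [← ContinuousLinearMap.coe_coe, LinearMap.pi_apply_eq_sum_univ]
  refine Finset.sum_congr rfl fun b _ => ?_
  rw [smul_eq_mul, mul_comm]
  congr 2
  ext c
  simp [Pi.single_apply, eq_comm]

theorem toMatrix'_apply_single (L : Vec ρ →L[ℝ] Vec n) :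
    (Matrix.of fun a b => L (Pi.single b 1) a) =
      LinearMap.toMatrix' (L : Vec ρ →ₗ[ℝ] Vec n) := by
  ext a b
  rw [LinearMap.toMatrix'_apply, Matrix.of_apply]
  congr 2

/-- Since `ζ` does not involve `x`, derivatives in `x` pass through the substitution and the chain
rule applies row by row. The numbers of old and new parameters may differ, as the essentiality
criterion requires. -/
theorem xJacobian_substitution (k : ℕ) (hF : SmoothNear (unc F) (t₀, x₀, ζ t₀ κ₀))
    (hζ : SmoothNear (fun p : ℝ × Vec ρ => ζ p.1 p.2) (t₀, κ₀))
    (e : ∀ᶠ q in 𝓝 (t₀, x₀, κ₀), f q.1 q.2.1 q.2.2 = F q.1 q.2.1 (ζ q.1 q.2.2)) :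
    xJacobian k f t₀ x₀ κ₀ = xJacobian k F t₀ x₀ (ζ t₀ κ₀) *
      Matrix.of fun a b => fderiv ℝ (ζ t₀) κ₀ (Pi.single b 1) a := by
  rw [(xJacobian_eventuallyEq (f' := fun t x κ => F t x (ζ t κ)) k e).self_of_nhds]
  ext i b
  have h1 : HasFDerivAt (fun c => dx i F t₀ x₀ c) _ (ζ t₀ κ₀) :=
    fderiv_slice_c (p := (t₀, x₀, ζ t₀ κ₀)) (hF.dx i).differentiableAt
  have h2 := h1.comp κ₀ hζ.slice_κ.differentiableAt.hasFDerivAt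
  have h3 : xJacobian k (fun t x κ => F t x (ζ t κ)) t₀ x₀ κ₀ i b =
      gradC (unc (dx i F)) (t₀, x₀, ζ t₀ κ₀) (fderiv ℝ (ζ t₀) κ₀ (Pi.single b 1)) :=
    congrArg (· (Pi.single b 1)) h2.fderiv
  rw [h3, ← xJacobian_mulVec hF k _ i]
  rfl

theorem dx_sub {a b : ℝ → ℝ → Vec ρ → ℝ} {p : ℝ × ℝ × Vec ρ} (k : ℕ) (ha : SmoothNear (unc a) p)
    (hb : SmoothNear (unc b) p) :
    dx k (fun t x c => a t x c - b t x c) p.1 p.2.1 p.2.2 =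
      dx k a p.1 p.2.1 p.2.2 - dx k b p.1 p.2.1 p.2.2 := by
  have h : ∀ {g : ℝ → ℝ → Vec ρ → ℝ}, SmoothNear (unc g) p →
      ContDiffAt ℝ k (fun y => g p.1 y p.2.2) p.2.1 := fun {g} hg => by
    have h1 : ContDiffAt ℝ k (unc g) p := hg.contDiffAt.of_le (mod_cast le_top)
    exact ContDiffAt.comp (g := unc g) (f := fun y : ℝ => (p.1, y, p.2.2)) p.2.1 h1 (by fun_prop)
  exact iteratedDeriv_fun_sub (h ha) (h hb)

/-- The `t`-derivative of `F(t, x, ζ(t, κ))`. -/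
theorem dt_substitution (hF : SmoothNear (unc F) (t₀, x₀, ζ t₀ κ₀))
    (hζ : SmoothNear (fun p : ℝ × Vec ρ => ζ p.1 p.2) (t₀, κ₀))
    (e : ∀ᶠ q in 𝓝 (t₀, x₀, κ₀), f q.1 q.2.1 q.2.2 = F q.1 q.2.1 (ζ q.1 q.2.2)) :
    dt f t₀ x₀ κ₀ = dirD eT (unc F) (t₀, x₀, ζ t₀ κ₀) +
      dirD (inC (deriv (fun s => ζ s κ₀) t₀)) (unc F) (t₀, x₀, ζ t₀ κ₀) := by
  have h0 : dt f t₀ x₀ κ₀ = dt (fun t x κ => F t x (ζ t κ)) t₀ x₀ κ₀ :=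
    (unc_dt_congr (f := f) (f' := fun t x κ => F t x (ζ t κ)) e).self_of_nhds
  have h1 : HasDerivAt (fun s : ℝ => ((s, x₀, ζ s κ₀) : ℝ × ℝ × Vec n))
      (eT + inC (deriv (fun s => ζ s κ₀) t₀)) t₀ := by
    refine ((hasDerivAt_id t₀).prodMk ((hasDerivAt_const t₀ x₀).prodMk
      hζ.differentiableAt_t.hasDerivAt)).congr_deriv ?_
    simp [eT]
  have h2 := hF.differentiableAt.hasFDerivAt.comp_hasDerivAt t₀ h1
  rw [h0]
  refine (HasDerivAt.deriv h2).trans ?_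
  rw [map_add]
  rfl

theorem dx_dt_substitution (k : ℕ) (hF : SmoothNear (unc F) (t₀, x₀, ζ t₀ κ₀))
    (hζ : SmoothNear (fun p : ℝ × Vec ρ => ζ p.1 p.2) (t₀, κ₀))
    (e : ∀ᶠ q in 𝓝 (t₀, x₀, κ₀), f q.1 q.2.1 q.2.2 = F q.1 q.2.1 (ζ q.1 q.2.2)) (i : Fin k) :
    dx i (dt f) t₀ x₀ κ₀ = dx i (dt F) t₀ x₀ (ζ t₀ κ₀) +
      Matrix.mulVec (xJacobian k F t₀ x₀ (ζ t₀ κ₀)) (deriv (fun s => ζ s κ₀) t₀) i := by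
  set c := ζ t₀ κ₀ with hc
  set v := deriv (fun s => ζ s κ₀) t₀ with hv
  -- The velocity `v` is frozen: it does not depend on `x`, so `B` agrees with `f_t` along the
  -- `x`-line through the point and has the same `x`-derivatives there.
  set B : ℝ → ℝ → Vec n → ℝ := fun t x c =>
    dirD eT (unc F) (t, x, c) + dirD (inC v) (unc F) (t, x, c) with hB
  have hBs : SmoothNear (unc B) (t₀, x₀, c) := (hF.dirD eT).add (hF.dirD (inC v))
  have h1 : ∀ᶠ y in 𝓝 x₀, dt f t₀ y κ₀ = B t₀ y c := by
    have hsl := tendsto_slice_x (t₀, x₀, κ₀)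
    filter_upwards [hsl.eventually ((tendsto_substitution hζ).eventually hF.eventually),
      hsl.eventually (eventually_eventually_nhds.2 e)] with y a1 a2
    exact dt_substitution a1 hζ a2
  have h2 : dx i (dt f) t₀ x₀ κ₀ = dx i B t₀ x₀ c := EventuallyEq.iteratedDeriv_eq i h1
  have h3 : dx i B t₀ x₀ c = (dirD eX)^[i] (unc B) (t₀, x₀, c) := (unc_dx i hBs).self_of_nhds
  have h4 := (iterate_dirD_add eX i (hF.dirD eT) (hF.dirD (inC v))).self_of_nhds
  have h5 : (dirD eX)^[i] (dirD eT (unc F)) (t₀, x₀, c) = dx i (dt F) t₀ x₀ c :=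
    ((unc_dx i hF.dt).trans (iterate_dirD_congr eX i (unc_dt hF))).self_of_nhds.symm
  have h6 : (dirD eX)^[i] (dirD (inC v) (unc F)) (t₀, x₀, c) =
      Matrix.mulVec (xJacobian k F t₀ x₀ c) v i := by
    rw [← (dirD_iterate_comm (inC v) eX i hF).self_of_nhds, xJacobian_mulVec hF k v i,
      (gradC_congr (unc_dx i hF)).self_of_nhds]
    rfl
  rw [h2, h3, ← h5, ← h6]
  exact h4

end Substitution

/-! ### An invertible Jacobian gives regularity and essential parameters -/

section Criteria

variable {ρ : ℕ} {f : ℝ → ℝ → Vec ρ → ℝ} {t₀ x₀ : ℝ} {κ₀ : Vec ρ}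

theorem rank_xJacobian_of_det_ne_zero {t x : ℝ} {c : Vec ρ} (h : (xJacobian ρ f t x c).det ≠ 0)
    {k : ℕ} (hk : k ≤ ρ) : (xJacobian k f t x c).rank = k := by
  rw [det_ne_zero_iff_rank, ← linearIndependent_row_iff_rank] at h
  rw [← linearIndependent_row_iff_rank]
  exact h.comp (Fin.castLE hk) (Fin.castLE_injective hk)

theorem eventually_det_ne_zero (hf : SmoothNear (unc f) (t₀, x₀, κ₀))
    (h : (xJacobian ρ f t₀ x₀ κ₀).det ≠ 0) :
    ∀ᶠ q in 𝓝 (t₀, x₀, κ₀), (xJacobian ρ f q.1 q.2.1 q.2.2).det ≠ 0 :=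
  (smoothNear_det fun i b => hf.xJacobian ρ i b).continuousAt.eventually_ne h

theorem regularAt_of_det_ne_zero (hf : SmoothNear (unc f) (t₀, x₀, κ₀))
    (h : (xJacobian ρ f t₀ x₀ κ₀).det ≠ 0) : RegularAt f t₀ x₀ κ₀ := by
  intro k hk
  filter_upwards [eventually_det_ne_zero hf h] with q hq
  rw [rank_xJacobian_of_det_ne_zero hq hk, rank_xJacobian_of_det_ne_zero h hk]

/-- A representation with `n < ρ` parameters factors the Jacobian through a matrix with `n` columns,
so its rank is below `ρ`. -/
theorem essentialParametersAt_of_det_ne_zero (h : (xJacobian ρ f t₀ x₀ κ₀).det ≠ 0) :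
    EssentialParametersAt f t₀ x₀ κ₀ := by
  rintro ⟨n, hn, g, ζ, hζ, hg, e⟩
  have hζ' : SmoothNear (fun p : ℝ × Vec ρ => ζ p.2) (t₀, κ₀) :=
    SmoothNear.comp (g := ζ) (f := fun p : ℝ × Vec ρ => p.2) hζ
      (smoothNear_of_contDiff contDiff_snd)
  have h1 := xJacobian_substitution (F := g) (ζ := fun _ => ζ) ρ hg hζ' e
  rw [det_ne_zero_iff_rank, h1] at h
  have h2 := Matrix.rank_mul_le_left (xJacobian ρ g t₀ x₀ (ζ κ₀))
    (Matrix.of fun a b => fderiv ℝ ζ κ₀ (Pi.single b 1) a)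
  have h3 := Matrix.rank_le_width (xJacobian ρ g t₀ x₀ (ζ κ₀))
  omega

end Criteria

/-! ### Reduced systems and time-dependent reparametrizations -/

section Reduction

variable {ρ : ℕ} {E : EvolEq} {t₀ x₀ : ℝ}

theorem smoothNear_rhs {F : ℝ → ℝ → Vec ρ → ℝ} {p : ℝ × ℝ × Vec ρ} (hF : SmoothNear (unc F) p)
    (hdom : xJet E.r F p.1 p.2.1 p.2.2 ∈ E.dom) :
    SmoothNear (unc fun t x c => E.H (xJet E.r F t x c)) p :=
  SmoothNear.comp (g := E.H) (f := fun q : ℝ × ℝ × Vec ρ => xJet E.r F q.1 q.2.1 q.2.2)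
    (smoothNear_H E hdom) (hF.xJet E.r)

theorem IsSolutionFamilyAt.isReducedSystem {f : ℝ → ℝ → Vec ρ → ℝ} {κ₀ : Vec ρ}
    (h : IsSolutionFamilyAt E f t₀ x₀ κ₀) : IsReducedSystem E f t₀ x₀ κ₀ fun _ _ => 0 := by
  filter_upwards [eventually_eventually_nhds.2 h.2.2] with q hq
  have h1 : unc (fun t x c => E.H (xJet E.r f t x c) - dt f t x c) =ᶠ[𝓝 q]
      unc fun _ _ _ => (0 : ℝ) := by
    filter_upwards [hq] with q' hq'
    exact sub_eq_zero.2 hq'.symm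
  have h2 : (fun b : Fin ρ => dx b (fun t x c => E.H (xJet E.r f t x c) - dt f t x c)
      q.1 q.2.1 q.2.2) = 0 := by
    ext b
    rw [dx_eq_of_eventuallyEq b h1]
    simp [dx]
  rw [reducedRHS, h2, Matrix.mulVec_zero]

theorem smoothNear_reducedRHS {F : ℝ → ℝ → Vec ρ → ℝ} {c₀ : Vec ρ}
    (hF : SmoothNear (unc F) (t₀, x₀, c₀)) (hdet : (xJacobian ρ F t₀ x₀ c₀).det ≠ 0)
    (hdom : xJet E.r F t₀ x₀ c₀ ∈ E.dom) :
    SmoothNear (fun q : ℝ × ℝ × Vec ρ => reducedRHS E F q.1 q.2.1 q.2.2) (t₀, x₀, c₀) := by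
  refine smoothNear_pi.2 fun a => ?_
  simp only [reducedRHS, Matrix.mulVec, dotProduct]
  refine SmoothNear.sum fun b _ => SmoothNear.mul ?_ ?_
  · exact smoothNear_inv (fun i b => hF.xJacobian ρ i b) hdet a b
  · exact SmoothNear.dx (f := fun t x c => E.H (xJet E.r F t x c) - dt F t x c) b
      ((smoothNear_rhs hF hdom).sub hF.dt)

/-- The function `G` in a reduced system is smooth. -/
theorem IsReducedSystem.smoothNear {F : ℝ → ℝ → Vec ρ → ℝ} {c₀ : Vec ρ}
    {G : ℝ → Vec ρ → Vec ρ} (hG : IsReducedSystem E F t₀ x₀ c₀ G)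
    (hF : SmoothNear (unc F) (t₀, x₀, c₀)) (hdet : (xJacobian ρ F t₀ x₀ c₀).det ≠ 0)
    (hdom : xJet E.r F t₀ x₀ c₀ ∈ E.dom) :
    SmoothNear (fun p : ℝ × Vec ρ => G p.1 p.2) (t₀, c₀) := by
  have h1 : SmoothNear (fun p : ℝ × Vec ρ => reducedRHS E F p.1 x₀ p.2) (t₀, c₀) :=
    SmoothNear.comp (g := fun q : ℝ × ℝ × Vec ρ => reducedRHS E F q.1 q.2.1 q.2.2)
      (f := fun p : ℝ × Vec ρ => (p.1, x₀, p.2)) (smoothNear_reducedRHS hF hdet hdom)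
      (smoothNear_of_contDiff (by fun_prop))
  refine h1.congr ?_
  filter_upwards [(tendsto_insert_x x₀).eventually hG] with p hp using hp.symm

variable {f F : ℝ → ℝ → Vec ρ → ℝ} {ζ : ℝ → Vec ρ → Vec ρ} {κ₀ : Vec ρ}

theorem eventually_xJet_substitution (r : ℕ)
    (e : ∀ᶠ q in 𝓝 (t₀, x₀, κ₀), f q.1 q.2.1 q.2.2 = F q.1 q.2.1 (ζ q.1 q.2.2)) :
    ∀ᶠ q in 𝓝 (t₀, x₀, κ₀),
      xJet r f q.1 q.2.1 q.2.2 = xJet r F q.1 q.2.1 (ζ q.1 q.2.2) :=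
  xJet_eventuallyEq (f' := fun t x κ => F t x (ζ t κ)) r e

/-- If `F(t, x, ζ(t, κ))` is a family of solutions, then `ζ` satisfies the system that results
from the substitution of the ansatz `F`. -/
theorem reducedRHS_substitution (hf : IsSolutionFamilyAt E f t₀ x₀ κ₀)
    (hF : SmoothNear (unc F) (t₀, x₀, ζ t₀ κ₀))
    (hζ : SmoothNear (fun p : ℝ × Vec ρ => ζ p.1 p.2) (t₀, κ₀))
    (hdet : (xJacobian ρ F t₀ x₀ (ζ t₀ κ₀)).det ≠ 0)
    (e : ∀ᶠ q in 𝓝 (t₀, x₀, κ₀), f q.1 q.2.1 q.2.2 = F q.1 q.2.1 (ζ q.1 q.2.2)) :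
    reducedRHS E F t₀ x₀ (ζ t₀ κ₀) = deriv (fun s => ζ s κ₀) t₀ := by
  have hj := eventually_xJet_substitution E.r e
  have hdom : xJet E.r F t₀ x₀ (ζ t₀ κ₀) ∈ E.dom := by
    rw [← hj.self_of_nhds]; exact hf.2.1
  have h1 : unc (dt f) =ᶠ[𝓝 (t₀, x₀, κ₀)]
      unc fun t x κ => E.H (xJet E.r F t x (ζ t κ)) := by
    filter_upwards [hf.2.2, hj] with q h1 h2
    change dt f q.1 q.2.1 q.2.2 = _
    rw [h1, h2]
    rfl
  have h2 : ∀ i : Fin ρ, dx i (fun t x c => E.H (xJet E.r F t x c) - dt F t x c) t₀ x₀ (ζ t₀ κ₀) =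
      Matrix.mulVec (xJacobian ρ F t₀ x₀ (ζ t₀ κ₀)) (deriv (fun s => ζ s κ₀) t₀) i := by
    intro i
    have a1 := dx_sub (p := (t₀, x₀, ζ t₀ κ₀)) i (smoothNear_rhs hF hdom) hF.dt
    have a2 := dx_dt_substitution ρ hF hζ e i
    have a3 : dx i (dt f) t₀ x₀ κ₀ = dx i (fun t x c => E.H (xJet E.r F t x c)) t₀ x₀ (ζ t₀ κ₀) :=
      dx_eq_of_eventuallyEq i h1
    simp only at a1
    rw [a1, ← a3, a2]
    ring
  rw [reducedRHS, funext h2, Matrix.mulVec_mulVec,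
    Matrix.nonsing_inv_mul _ (isUnit_iff_ne_zero.2 hdet), Matrix.one_mulVec]

/-- Substituting a general solution of a reduced system into the ansatz yields a family of
solutions. -/
theorem isSolutionFamilyAt_substitution (hρ : 1 ≤ ρ) {c₀ : Vec ρ} {G : ℝ → Vec ρ → Vec ρ}
    (hF : SmoothNear (unc F) (t₀, x₀, c₀)) (hdet : (xJacobian ρ F t₀ x₀ c₀).det ≠ 0)
    (hdom : xJet E.r F t₀ x₀ c₀ ∈ E.dom) (hG : IsReducedSystem E F t₀ x₀ c₀ G)
    (hζ : IsGeneralSolution G ζ t₀ c₀ κ₀) :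
    IsSolutionFamilyAt E (fun t x κ => F t x (ζ t κ)) t₀ x₀ κ₀ := by
  obtain ⟨rfl, hs, hd, -⟩ := hζ
  refine ⟨hF.substitution hs, hdom, ?_⟩
  have ht := tendsto_substitution (x₀ := x₀) hs
  filter_upwards [ht.eventually hF.eventually, ht.eventually (eventually_det_ne_zero hF hdet),
    ht.eventually hG, tendsto_forget_x.eventually hs.eventually, tendsto_forget_x.eventually hd]
    with q h1 h2 h3 h4 h5
  -- Row `0`, available since `ρ ≥ 1`, is the undifferentiated equation.
  have h6 := dx_dt_substitution (f := fun t x κ => F t x (ζ t κ)) ρ h1 h4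
    (Eventually.of_forall fun _ => rfl) ⟨0, hρ⟩
  have h7 : Matrix.mulVec (xJacobian ρ F q.1 q.2.1 (ζ q.1 q.2.2))
      (deriv (fun s => ζ s q.2.2) q.1) = fun b : Fin ρ =>
        dx b (fun t x c => E.H (xJet E.r F t x c) - dt F t x c) q.1 q.2.1 (ζ q.1 q.2.2) := by
    rw [h5.deriv]
    rw [← h3, reducedRHS, Matrix.mulVec_mulVec,
      Matrix.mul_nonsing_inv _ (isUnit_iff_ne_zero.2 h2), Matrix.one_mulVec]
  rw [h7] at h6
  simp only [dx, iteratedDeriv_zero] at h6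
  rw [h6]
  change _ + (E.H (xJet E.r F q.1 q.2.1 (ζ q.1 q.2.2)) - _) = _
  rw [add_sub_cancel]
  rfl

theorem IsTimeReparam.det_ne_zero {c₀ : Vec ρ} (h : IsTimeReparam ζ t₀ κ₀ c₀) :
    (Matrix.of fun a b : Fin ρ => fderiv ℝ (ζ t₀) κ₀ (Pi.single b 1) a).det ≠ 0 := by
  obtain ⟨rfl, hζ, ξ, hξ, h1, -⟩ := h
  have a1 := hζ.slice_κ.differentiableAt.hasFDerivAt
  have a2 := hξ.slice_κ.differentiableAt.hasFDerivAt
  have a3 := (a2.comp κ₀ a1).unique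
    ((hasFDerivAt_id κ₀).congr_of_eventuallyEq ((tendsto_insert_t t₀).eventually h1))
  rw [toMatrix'_apply_single]
  have a4 : LinearMap.toMatrix' (fderiv ℝ (ξ t₀) (ζ t₀ κ₀) : Vec ρ →ₗ[ℝ] Vec ρ) *
      LinearMap.toMatrix' (fderiv ℝ (ζ t₀) κ₀ : Vec ρ →ₗ[ℝ] Vec ρ) = 1 := by
    rw [← LinearMap.toMatrix'_comp, ← ContinuousLinearMap.toLinearMap_comp, a3]
    exact LinearMap.toMatrix'_id
  exact (Matrix.isUnit_iff_isUnit_det _).1 (IsUnit.of_mul_eq_one_right _ a4) |>.ne_zero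

/-- Inverse function theorem for `(t, κ) ↦ (t, ζ(t, κ))`, whose differential is block triangular
with `∂ζ/∂κ` on the diagonal. -/
theorem isTimeReparam_of_det_ne_zero (hζ : SmoothNear (fun p : ℝ × Vec ρ => ζ p.1 p.2) (t₀, κ₀))
    (hdet : (Matrix.of fun a b : Fin ρ => fderiv ℝ (ζ t₀) κ₀ (Pi.single b 1) a).det ≠ 0) :
    IsTimeReparam ζ t₀ κ₀ (ζ t₀ κ₀) := by
  set T : ℝ × Vec ρ → ℝ × Vec ρ := fun p => (p.1, ζ p.1 p.2) with hT
  have hTs : SmoothNear T (t₀, κ₀) := hζ.withTime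
  set Z := fderiv ℝ (fun p : ℝ × Vec ρ => ζ p.1 p.2) (t₀, κ₀) with hZ
  have hZd : HasFDerivAt (fun p : ℝ × Vec ρ => ζ p.1 p.2) Z (t₀, κ₀) :=
    hζ.differentiableAt.hasFDerivAt
  set D : ℝ × Vec ρ →L[ℝ] ℝ × Vec ρ := (ContinuousLinearMap.fst ℝ ℝ (Vec ρ)).prod Z with hD
  have hTd : HasFDerivAt T D (t₀, κ₀) := hasFDerivAt_fst.prodMk hZd
  have hZκ : ∀ v, Z (0, v) = fderiv ℝ (ζ t₀) κ₀ v := by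
    intro v
    have h1 : HasFDerivAt (fun κ : Vec ρ => (t₀, κ)) (ContinuousLinearMap.inr ℝ ℝ (Vec ρ)) κ₀ :=
      hasFDerivAt_prodMk_right t₀ κ₀
    have h2 : HasFDerivAt (ζ t₀) _ κ₀ :=
      HasFDerivAt.comp (g := fun p : ℝ × Vec ρ => ζ p.1 p.2) κ₀ hZd h1
    rw [h2.fderiv]
    rfl
  have hinj : Function.Injective (D : ℝ × Vec ρ →ₗ[ℝ] ℝ × Vec ρ) := by
    refine (injective_iff_map_eq_zero _).2 ?_
    rintro ⟨s, v⟩ h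
    have h1 : s = 0 := congrArg Prod.fst h
    subst h1
    have h2 : Z (0, v) = 0 := congrArg Prod.snd h
    rw [hZκ] at h2
    rw [toMatrix'_apply_single] at hdet
    have h3 : v = 0 := by
      refine Matrix.eq_zero_of_mulVec_eq_zero hdet ?_
      rw [← Matrix.toLin'_apply, Matrix.toLin'_toMatrix']
      exact h2
    rw [h3]; rfl
  let L : (ℝ × Vec ρ) ≃L[ℝ] ℝ × Vec ρ :=
    (LinearEquiv.ofInjectiveEndo (D : ℝ × Vec ρ →ₗ[ℝ] ℝ × Vec ρ) hinj).toContinuousLinearEquiv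
  have hL : (L : ℝ × Vec ρ →L[ℝ] ℝ × Vec ρ) = D := by
    exact ContinuousLinearMap.ext fun v => rfl
  obtain ⟨g, hg, -, hg1, hg2⟩ := hTs.exists_localInverse (f' := L) (by rw [hL]; exact hTd)
  refine ⟨rfl, hζ, fun t c => (g (t, c)).2, ?_, ?_, ?_⟩
  · exact hg.clm_comp_left (ContinuousLinearMap.snd ℝ ℝ (Vec ρ))
  · filter_upwards [hg1] with p hp
    have : g (p.1, ζ p.1 p.2) = p := hp
    rw [this]
  · filter_upwards [hg2] with p hp
    obtain ⟨h1, h2⟩ : (g p).1 = p.1 ∧ ζ (g p).1 (g p).2 = p.2 := Prod.ext_iff.1 hp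
    rwa [h1] at h2

end Reduction

/-! ### Density of regular points -/

section GenericPoints

variable {ρ : ℕ} {f : ℝ → ℝ → Vec ρ → ℝ} {p : ℝ × ℝ × Vec ρ}

/-- Vectors whose images form a basis of the range at `z` keep independent images nearby, because
linear independence is an open condition. -/
theorem eventually_rank_le {X : Type*} [TopologicalSpace X] {k n : ℕ}
    {M : X → Matrix (Fin k) (Fin n) ℝ} {z : X}
    (hM : ∀ i j, ContinuousAt (fun y => M y i j) z) : ∀ᶠ y in 𝓝 z, (M z).rank ≤ (M y).rank := by
  set b := Module.finBasis ℝ (LinearMap.range (M z).mulVecLin) with hb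
  have hw : ∀ j, ∃ v, (M z).mulVecLin v = b j := fun j => (b j).2
  choose v hv using hw
  have hli : LinearIndependent ℝ fun j => (M z).mulVec (v j) := by
    have h1 := b.linearIndependent.map' (Submodule.subtype _) (Submodule.ker_subtype _)
    have h2 : (fun j => (M z).mulVec (v j)) = Submodule.subtype _ ∘ b := funext hv
    rw [h2]
    exact h1
  have hc : ContinuousAt (fun y => fun j => (M y).mulVec (v j)) z := by
    refine continuousAt_pi.2 fun j => continuousAt_pi.2 fun i => ?_
    simp only [Matrix.mulVec, dotProduct]
    exact tendsto_finsetSum _ fun l _ => (hM i l).mul_const _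
  filter_upwards [hc.eventually hli.eventually] with y hy
  have h1 : Submodule.span ℝ (Set.range fun j => (M y).mulVec (v j)) ≤
      LinearMap.range (M y).mulVecLin := by
    rw [Submodule.span_le]
    rintro _ ⟨j, rfl⟩
    exact ⟨v j, rfl⟩
  have h2 := Submodule.finrank_mono h1
  rw [finrank_span_eq_card hy, Fintype.card_fin] at h2
  exact h2

/-- The regular points of a smooth function are dense. -/
theorem subset_closure_regularAt {U : Set (ℝ × ℝ × Vec ρ)} (hU : IsOpen U)
    (hf : ∀ p ∈ U, SmoothNear (unc f) p) :
    U ⊆ closure {p ∈ U | RegularAt f p.1 p.2.1 p.2.2} := by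
  intro p hp
  refine mem_closure_iff.2 fun V hV hpV => ?_
  set R : ℝ × ℝ × Vec ρ → ℕ :=
    fun q => ∑ k ∈ Finset.range (ρ + 1), (xJacobian k f q.1 q.2.1 q.2.2).rank with hR
  set B : ℕ := ∑ k ∈ Finset.range (ρ + 1), k with hB
  have hRB : ∀ q, R q ≤ B := fun q => Finset.sum_le_sum fun k _ => Matrix.rank_le_height _
  -- A point maximizing the bounded sum of ranks. Nearby no rank can drop and the sum cannot grow,
  -- so every rank is constant.
  obtain ⟨q, ⟨hqV, hqU⟩, hmax⟩ := (measure fun q => B - R q).wf.has_min (V ∩ U) ⟨p, hpV, hp⟩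
  refine ⟨q, hqV, hqU, fun k hk => ?_⟩
  have hlsc : ∀ᶠ q' in 𝓝 q, ∀ k ∈ Finset.range (ρ + 1), (xJacobian k f q.1 q.2.1 q.2.2).rank ≤
      (xJacobian k f q'.1 q'.2.1 q'.2.2).rank :=
    (eventually_all_finset _).2 fun k _ =>
      eventually_rank_le (M := fun q : ℝ × ℝ × Vec ρ => xJacobian k f q.1 q.2.1 q.2.2)
        fun i j => ((hf q hqU).xJacobian k i j).continuousAt
  filter_upwards [hlsc, (hV.inter hU).mem_nhds ⟨hqV, hqU⟩] with q' h1 h2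
  have h3 : ¬ B - R q' < B - R q := hmax q' h2
  have h4 : R q = R q' := by
    have h5 : R q ≤ R q' := Finset.sum_le_sum h1
    have := hRB q'
    omega
  exact ((Finset.sum_eq_sum_iff_of_le h1).1 h4 k (Finset.mem_range.2 (by omega))).symm

end GenericPoints

/-! ### The bijection of equivalence classes -/

section Correspondence

variable {E : EvolEq} {ρ : ℕ} {t₀ x₀ : ℝ}

/-- A parametric family of solutions, read as an ansatz. -/
def SolutionFamily.toAnsatz (S : SolutionFamily E ρ t₀ x₀) : Ansatz ρ t₀ x₀ where
  F := S.f
  c₀ := S.κ₀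
  smooth_F := S.isSolution.1
  det_ne_zero := S.isSolution.det_ne_zero S.essential S.regular

/-- A parametric family of solutions, read as an ansatz that reduces the equation. -/
def SolutionFamily.toReducingAnsatz (S : SolutionFamily E ρ t₀ x₀) : ReducingAnsatz E ρ t₀ x₀ :=
  ⟨S.toAnsatz, S.isSolution.2.1, fun _ _ => 0, S.isSolution.isReducedSystem⟩

/-- A reparametrization that turns an ansatz into a family of solutions is the general solution of
the reduced system. -/
theorem IsTimeReparam.isGeneralSolution {S : SolutionFamily E ρ t₀ x₀} {A : Ansatz ρ t₀ x₀}
    {G ζ : ℝ → Vec ρ → Vec ρ} (hG : IsReducedSystem E A.F t₀ x₀ A.c₀ G)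
    (hζ : IsTimeReparam ζ t₀ S.κ₀ A.c₀)
    (e : ∀ᶠ p in 𝓝 (t₀, x₀, S.κ₀), A.F p.1 p.2.1 (ζ p.1 p.2.2) = S.f p.1 p.2.1 p.2.2) :
    IsGeneralSolution G ζ t₀ A.c₀ S.κ₀ := by
  have hdet := hζ.det_ne_zero
  obtain ⟨h0, hs, -⟩ := hζ
  have hF : SmoothNear (unc A.F) (t₀, x₀, ζ t₀ S.κ₀) := by rw [h0]; exact A.smooth_F
  have hFdet : (xJacobian ρ A.F t₀ x₀ (ζ t₀ S.κ₀)).det ≠ 0 := by rw [h0]; exact A.det_ne_zero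
  have ht := tendsto_substitution (x₀ := x₀) hs
  -- The differential equation for `ζ` is needed at all nearby points, while
  -- `reducedRHS_substitution` speaks of a base point; its hypotheses are open, so the base point
  -- may move.
  have hsol : ∀ᶠ q in 𝓝 (t₀, x₀, S.κ₀), IsSolutionFamilyAt E S.f q.1 q.2.1 q.2.2 := by
    have hf : SmoothNear (unc S.f) (t₀, x₀, S.κ₀) := S.isSolution.1
    filter_upwards [hf.eventually, eventually_eventually_nhds.2 S.isSolution.2.2,
      (hf.xJet E.r).continuousAt.eventually_mem (E.isOpen_dom.mem_nhds S.isSolution.2.1)]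
      with q h1 h2 h3 using ⟨h1, h3, h2⟩
  rw [← h0] at hG
  have key : ∀ᶠ q in 𝓝 (t₀, x₀, S.κ₀),
      HasDerivAt (fun s => ζ s q.2.2) (G q.1 (ζ q.1 q.2.2)) q.1 := by
    filter_upwards [hsol, ht.eventually hF.eventually,
      ht.eventually (eventually_det_ne_zero hF hFdet), ht.eventually hG,
      tendsto_forget_x.eventually hs.eventually, eventually_eventually_nhds.2 e]
      with q h1 h2 h3 h4 h5 h6
    rw [← h4, reducedRHS_substitution h1 h2 h5 h3 (h6.mono fun _ h => h.symm)]
    exact h5.differentiableAt_t.hasDerivAt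
  exact ⟨h0, hs, (tendsto_insert_x x₀).eventually key, hdet⟩

/-- The same function serves on both sides: an equivalence solves the reduced system, and a general
solution is invertible in `κ` by its determinant condition. -/
theorem SolutionFamily.equivalent_iff_isObtainedFrom (S : SolutionFamily E ρ t₀ x₀)
    (A : ReducingAnsatz E ρ t₀ x₀) :
    S.toAnsatz.Equivalent A.1 ↔ S.IsObtainedFrom A.1 := by
  constructor
  · rintro ⟨ζ, hζ, e⟩
    obtain ⟨-, G, hG⟩ := A.2
    exact ⟨G, ζ, hG, IsTimeReparam.isGeneralSolution hG hζ e, e.mono fun _ h => h.symm⟩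
  · rintro ⟨G, ψ, -, ⟨h0, hs, -, hdet⟩, e⟩
    refine ⟨ψ, ?_, e.mono fun _ h => h.symm⟩
    rw [← h0]
    exact isTimeReparam_of_det_ne_zero hs hdet

/-- Equivalent families of solutions are equivalent as ansatzes, and conversely. -/
theorem SolutionFamily.toAnsatz_equivalent_iff (S S' : SolutionFamily E ρ t₀ x₀) :
    S.toAnsatz.Equivalent S'.toAnsatz ↔ S.Equivalent S' := by
  constructor
  · rintro ⟨ζ, hζ, e⟩
    -- The ansatz `S'` reduces the equation to `φ_t = 0`, so `ζ` is constant in `t` and `ζ t₀` is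
    -- the required reparametrization.
    obtain ⟨-, -, hd, -⟩ := IsTimeReparam.isGeneralSolution (S := S) (A := S'.toAnsatz)
      S'.isSolution.isReducedSystem hζ e
    have hconst := eventually_eq_of_hasDerivAt_zero hd
    obtain ⟨h0, hs, ξ, hξ, h1, h2⟩ := hζ
    refine ⟨ζ t₀, ⟨h0, hs.slice_κ, ξ t₀, hξ.slice_κ, (tendsto_insert_t t₀).eventually h1,
      (tendsto_insert_t t₀).eventually h2⟩, ?_⟩
    filter_upwards [e, tendsto_forget_x.eventually hconst] with q h3 h4
    rw [← h4]
    exact h3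
  · rintro ⟨ζ, ⟨h0, hs, ξ, hξ, h1, h2⟩, e⟩
    have hsnd : ∀ κ : Vec ρ, Tendsto (fun p : ℝ × Vec ρ => p.2) (𝓝 (t₀, κ)) (𝓝 κ) :=
      fun _ => Continuous.tendsto' (by fun_prop) _ _ rfl
    exact ⟨fun _ => ζ, ⟨h0, SmoothNear.comp (g := ζ) (f := fun p : ℝ × Vec ρ => p.2) hs
      (smoothNear_of_contDiff contDiff_snd), fun _ => ξ,
      SmoothNear.comp (g := ξ) (f := fun p : ℝ × Vec ρ => p.2) hξ
        (smoothNear_of_contDiff contDiff_snd), (hsnd _).eventually h1, (hsnd _).eventually h2⟩, e⟩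

/-- Each reducing ansatz yields a parametric family of solutions. -/
theorem ReducingAnsatz.exists_isObtainedFrom (hρ : 1 ≤ ρ) (A : ReducingAnsatz E ρ t₀ x₀) :
    ∃ S : SolutionFamily E ρ t₀ x₀, S.IsObtainedFrom A.1 := by
  obtain ⟨A, hdom, G, hG⟩ := A
  have hF : SmoothNear (unc A.F) (t₀, x₀, A.c₀) := A.smooth_F
  obtain ⟨ψ, hψ⟩ := exists_generalSolution (hG.smoothNear hF A.det_ne_zero hdom)
  have hsol := isSolutionFamilyAt_substitution hρ hF A.det_ne_zero hdom hG hψ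
  -- The Jacobian is the product of `Φ` and `∂ψ/∂κ`, both invertible; essential parameters and
  -- regularity follow from this alone.
  have hdet : (xJacobian ρ (fun t x κ => A.F t x (ψ t κ)) t₀ x₀ A.c₀).det ≠ 0 := by
    obtain ⟨h0, hs, -, hd⟩ := hψ
    have hF' : SmoothNear (unc A.F) (t₀, x₀, ψ t₀ A.c₀) := by rw [h0]; exact hF
    rw [xJacobian_substitution ρ hF' hs (Eventually.of_forall fun _ => rfl), Matrix.det_mul, h0]
    exact mul_ne_zero A.det_ne_zero hd
  exact ⟨⟨fun t x κ => A.F t x (ψ t κ), A.c₀, hsol, essentialParametersAt_of_det_ne_zero hdet,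
    regularAt_of_det_ne_zero hsol.1 hdet⟩, G, ψ, hG, hψ, Eventually.of_forall fun _ => rfl⟩

/-- The class of a family of solutions is mapped to the class of this family, read as an ansatz. -/
def classMap (E : EvolEq) (ρ : ℕ) (t₀ x₀ : ℝ) :
    SolutionFamilyClass E ρ t₀ x₀ → ReducingAnsatzClass E ρ t₀ x₀ :=
  Quotient.map' SolutionFamily.toReducingAnsatz fun S S' h =>
    (S.toAnsatz_equivalent_iff S').2 h

theorem classMap_mk_eq_iff (S : SolutionFamily E ρ t₀ x₀) (A : ReducingAnsatz E ρ t₀ x₀) :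
    classMap E ρ t₀ x₀ (Quotient.mk _ S) = Quotient.mk _ A ↔ S.IsObtainedFrom A.1 := by
  rw [← S.equivalent_iff_isObtainedFrom]
  exact Quotient.eq (r := ReducingAnsatz.setoid E ρ t₀ x₀)

theorem classMap_bijective (hρ : 1 ≤ ρ) : Function.Bijective (classMap E ρ t₀ x₀) := by
  constructor
  · intro a b
    refine Quotient.inductionOn₂ a b fun S S' h => ?_
    refine Quotient.sound ?_
    exact (S.toAnsatz_equivalent_iff S').1
      ((Quotient.eq (r := ReducingAnsatz.setoid E ρ t₀ x₀)).1 h)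
  · intro a
    refine Quotient.inductionOn a fun A => ?_
    obtain ⟨S, hS⟩ := ReducingAnsatz.exists_isObtainedFrom hρ A
    exact ⟨Quotient.mk _ S, (classMap_mk_eq_iff S A).2 hS⟩

end Correspondence

end EvolAnsatz
end

open EvolAnsatz in
theorem mainTheorem4 (E : EvolEq) (ρ : ℕ) (hρ : 1 ≤ ρ) :
    -- the one-to-one correspondence, near any point `(t₀, x₀)`
    (∀ t₀ x₀ : ℝ,
      ∃ e : SolutionFamilyClass E ρ t₀ x₀ ≃ ReducingAnsatzClass E ρ t₀ x₀,
        -- classes correspond iff the family arises from the general solution of the reduced system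
        (∀ (S : SolutionFamily E ρ t₀ x₀) (A : ReducingAnsatz E ρ t₀ x₀),
          e (Quotient.mk _ S) = Quotient.mk _ A ↔ S.IsObtainedFrom A.1) ∧
        -- the family itself, read as an ansatz, reduces `E` to the system `φ_t = 0`
        (∀ S : SolutionFamily E ρ t₀ x₀, ∃ A : ReducingAnsatz E ρ t₀ x₀,
          A.1.F = S.f ∧ A.1.c₀ = S.κ₀ ∧
          IsReducedSystem E A.1.F t₀ x₀ A.1.c₀ (fun _ _ => 0) ∧
          e (Quotient.mk _ S) = Quotient.mk _ A)) ∧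
    -- families of solutions with essential parameters are regular at generic points
    (∀ (U : Set (ℝ × ℝ × Vec ρ)) (f : ℝ → ℝ → Vec ρ → ℝ), IsOpen U →
      (∀ p ∈ U, IsSolutionFamilyAt E f p.1 p.2.1 p.2.2 ∧
        EssentialParametersAt f p.1 p.2.1 p.2.2) →
      U ⊆ closure {p ∈ U | RegularAt f p.1 p.2.1 p.2.2}) := by
  refine ⟨fun t₀ x₀ => ⟨Equiv.ofBijective (classMap E ρ t₀ x₀) (classMap_bijective hρ),
    classMap_mk_eq_iff, fun S => ⟨S.toReducingAnsatz, rfl, rfl, S.isSolution.isReducedSystem, rfl⟩⟩,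
    fun U f hU h => subset_closure_regularAt hU fun p hp => (h p hp).1.1⟩
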